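/- Let $S^n$ denote the unit sphere with its angular metric ($S^{-1}=\emptyset$). Let $B$ be a (complete) spherical building of dimension $n\ge 0$ with its CAT(1) metric, not necessarily thick or irreducible: that is, a complete CAT(1) space together with a finite group $W$ of isometries of $S^n$ generated by reflections in hyperplanes and a collection of isometric embeddings $\iota:S^n\to B$ (charts), closed under precomposition with elements of $W$, such that any two points of $B$ lie in the image of a common chart, and such that for any two charts $\iota_1,\iota_2$ the map $\iota_1^{-1}\circ\iota_2$, where defined, is the restriction of an element of $W$. The apartments of $B$ are the images of the charts. For $x\in B$ let $\Sigma_xB$ be the space of directions at $x$ (geodesics starting at $x$, identified if their angle is zero, with the angle as metric); it is an $(n-1)$-dimensional spherical building, whose apartments (for the maximal system of apartments) are the subsets isometric to $S^{n-1}$. For a subset $C\subset B$ containing $x$, let $\Sigma_xC\subset\Sigma_xB$ be the set of directions of geodesics that start at $x$ and run in $C$. Let $C\subset B$ be a closed subset that is convex (for any $y,z\in C$ with $d(y,z)<\pi$, the set $C$ contains the unique geodesic of $B$ between $y$ and $z$) and spherical (isometric to a subset of a unit sphere $S^k$ of some dimension $k$). Let $x\in C$, and let $A_x$ be an apartment of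 $\Sigma_xB$ with $\Sigma_xC\subset A_x$. Then there exists an apartment $A$ of $B$ such that $C\subset A$ and $\Sigma_xA=A_x$. -/

import Mathlib

open Filter Topology Metric

noncomputable section

namespace SphBuild

/-! ### Euclidean space and the round unit sphere -/

/-- Euclidean space of dimension `d`. -/
abbrev E (d : ℕ) : Type := EuclideanSpace ℝ (Fin d)

/-- The unit sphere of `E d`, a sphere of dimension `d - 1` (the empty set for `d = 0`).
Its intrinsic (round) metric is the angular one, so below the distance of `u` and `v` is always
written `InnerProductGeometry.angle u v`. -/
abbrev USphere (d : ℕ) : Type := sphere (0 : E d) 1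

/-- The round distance of two points of the unit sphere. -/
def angDist {d : ℕ} (u v : USphere d) : ℝ := InnerProductGeometry.angle (u : E d) (v : E d)

/-- A distance preserving map from the unit sphere with its round metric. -/
def IsSphereEmbedding {M : Type*} [PseudoMetricSpace M] {d : ℕ} (f : USphere d → M) : Prop :=
  ∀ u v, dist (f u) (f v) = angDist u v

/-- `A` is isometric to the round unit sphere of `E d`. -/
def IsRoundSphere {M : Type*} [PseudoMetricSpace M] (d : ℕ) (A : Set M) : Prop :=
  ∃ f : USphere d → M, IsSphereEmbedding f ∧ Set.range f = A

/-- `C` is isometric to a subset of a round unit sphere of some dimension `k`. -/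
def IsSpherical {M : Type*} [PseudoMetricSpace M] (C : Set M) : Prop :=
  ∃ (k : ℕ) (f : C → USphere (k + 1)), ∀ a b : C, angDist (f a) (f b) = dist a b

/-- The action of a linear isometry on the unit sphere. -/
def sphereMap {d : ℕ} (w : E d ≃ₗᵢ[ℝ] E d) (u : USphere d) : USphere d :=
  ⟨w u, by simp⟩

/-! ### Geodesics, convexity, CAT(1) spaces -/

/-- `z` lies between `a` and `b`, that is (in a space in which points at distance less than `π`
are joined by geodesics, and for `a`, `b` at distance less than `π`) on a geodesic
from `a` to `b`. -/
def Between {M : Type*} [PseudoMetricSpace M] (a z b : M) : Prop :=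
  dist a z + dist z b = dist a b

/-- A subset is convex if it contains the geodesic between any two of its points that are at
distance less than `π`. -/
def IsConvex {M : Type*} [PseudoMetricSpace M] (C : Set M) : Prop :=
  ∀ a ∈ C, ∀ b ∈ C, dist a b < Real.pi → ∀ z, Between a z b → z ∈ C

/-- CAT(1) spaces: points at distance less than `π` are joined by a geodesic, and geodesic
triangles of perimeter less than `2π` are not thicker than their comparison triangles in the
unit sphere of dimension two. Here `a` and `b` are points on the sides `pq` and `pr`. -/
structure IsCAT1 (M : Type*) [PseudoMetricSpace M] : Prop where
  exists_geodesic : ∀ p q : M, dist p q < Real.pi →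
    ∃ c : ℝ → M, c 0 = p ∧ c (dist p q) = q ∧
      ∀ s ∈ Set.Icc 0 (dist p q), ∀ t ∈ Set.Icc 0 (dist p q), dist (c s) (c t) = |s - t|
  comparison : ∀ p q r a b : M, dist p q + dist q r + dist r p < 2 * Real.pi →
    Between p a q → Between p b r →
    ∀ p' q' r' a' b' : USphere 3,
      angDist p' q' = dist p q → angDist q' r' = dist q r → angDist r' p' = dist r p →
      angDist p' a' = dist p a → angDist a' q' = dist a q →
      angDist p' b' = dist p b → angDist b' r' = dist b r →
      dist a b ≤ angDist a' b'

/-! ### Spherical buildings -/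

/-- A finite group of isometries of the unit sphere of `E d` that is generated by reflections in
hyperplanes, in other words the Weyl group of a spherical Coxeter complex on that sphere. -/
def IsFiniteReflectionGroup {d : ℕ} (W : Subgroup (E d ≃ₗᵢ[ℝ] E d)) : Prop :=
  Finite W ∧ ∃ R : Set (E d ≃ₗᵢ[ℝ] E d),
    (∀ r ∈ R, ∃ v : E d, v ≠ 0 ∧ r = (Submodule.span ℝ {v})ᗮ.reflection) ∧
    W = Subgroup.closure R

/-- The structure of an `n`-dimensional spherical building on a metric space `B`: it is a
CAT(1) space with an atlas of isometric embeddings (charts) of the round sphere `Sⁿ`, closed under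
precomposition with the Weyl group `W` of a spherical Coxeter complex on `Sⁿ`, such that any two
points lie in the image of a common chart, and such that the transition map of any two charts is
the restriction of an element of `W`. Thickness and irreducibility are not required. -/
structure SphericalBuilding (n : ℕ) (B : Type*) [MetricSpace B] where
  W : Subgroup (E (n + 1) ≃ₗᵢ[ℝ] E (n + 1))
  isReflectionGroup : IsFiniteReflectionGroup W
  charts : Set (USphere (n + 1) → B)
  cat1 : IsCAT1 B
  isometric : ∀ ι ∈ charts, IsSphereEmbedding ι
  comp_mem : ∀ ι ∈ charts, ∀ w ∈ W, ι ∘ sphereMap w ∈ charts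
  plenty : ∀ a b : B, ∃ ι ∈ charts, a ∈ Set.range ι ∧ b ∈ Set.range ι
  compatible : ∀ ι₁ ∈ charts, ∀ ι₂ ∈ charts, ∃ w ∈ W,
    ∀ u v, ι₁ u = ι₂ v → u = sphereMap w v

/-- Apartments are the images of the charts. -/
def SphericalBuilding.IsApartment {n : ℕ} {B : Type*} [MetricSpace B]
    (X : SphericalBuilding n B) (A : Set B) : Prop :=
  ∃ ι ∈ X.charts, Set.range ι = A

/-! ### Angles and the space of directions -/

/-- The Euclidean comparison angle at `p`. -/
def compAngle {M : Type*} [PseudoMetricSpace M] (p a b : M) : ℝ :=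
  Real.arccos ((dist p a ^ 2 + dist p b ^ 2 - dist a b ^ 2) / (2 * dist p a * dist p b))

/-- A unit speed geodesic segment of positive length that starts at `x`
(only the values on `[0, length]` matter). -/
structure GeodesicFrom {M : Type*} [PseudoMetricSpace M] (x : M) where
  length : ℝ
  length_pos : 0 < length
  toFun : ℝ → M
  map_zero : toFun 0 = x
  isometric : ∀ s ∈ Set.Icc 0 length, ∀ t ∈ Set.Icc 0 length, dist (toFun s) (toFun t) = |s - t|

/-- The (upper, Alexandrov) angle between two geodesics with the same starting point. -/
def gAngle {M : Type*} [PseudoMetricSpace M] {x : M} (c c' : GeodesicFrom x) : ℝ :=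
  limsup (fun p : ℝ × ℝ => compAngle x (c.toFun p.1) (c'.toFun p.2)) (𝓝[>] 0 ×ˢ 𝓝[>] 0)

section angle

variable {M : Type*} [PseudoMetricSpace M] {x : M}

theorem compAngle_nonneg (p a b : M) : 0 ≤ compAngle p a b := Real.arccos_nonneg _

theorem compAngle_le_pi (p a b : M) : compAngle p a b ≤ Real.pi := Real.arccos_le_pi _

theorem compAngle_comm (p a b : M) : compAngle p a b = compAngle p b a := by
  unfold compAngle
  rw [dist_comm a b]
  congr 1
  ring

theorem compAngle_bdd (f : ℝ × ℝ → M × M) (l : Filter (ℝ × ℝ)) :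
    IsBoundedUnder (· ≤ ·) l (fun p => compAngle x (f p).1 (f p).2) :=
  isBoundedUnder_of ⟨Real.pi, fun _ => compAngle_le_pi _ _ _⟩

theorem compAngle_cobdd (f : ℝ × ℝ → M × M) (l : Filter (ℝ × ℝ)) [l.NeBot] :
    IsCoboundedUnder (· ≤ ·) l (fun p => compAngle x (f p).1 (f p).2) :=
  (isBoundedUnder_of ⟨0, fun _ => compAngle_nonneg _ _ _⟩ :
    IsBoundedUnder (· ≥ ·) l _).isCoboundedUnder_le

theorem dist_start (c : GeodesicFrom x) {t : ℝ} (h0 : 0 ≤ t) (ht : t ≤ c.length) :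
    dist x (c.toFun t) = t := by
  have h := c.isometric 0 ⟨le_rfl, c.length_pos.le⟩ t ⟨h0, ht⟩
  rw [c.map_zero] at h
  rw [h, zero_sub, abs_neg, abs_of_nonneg h0]

theorem gAngle_nonneg (c c' : GeodesicFrom x) : 0 ≤ gAngle c c' :=
  le_limsup_of_frequently_le (Eventually.frequently (Eventually.of_forall
    fun _ => compAngle_nonneg _ _ _)) (compAngle_bdd (fun p => (c.toFun p.1, c'.toFun p.2)) _)

theorem gAngle_self (c : GeodesicFrom x) : gAngle c c = 0 := by
  have hev : ∀ᶠ t in 𝓝[>] (0 : ℝ), 0 < t ∧ t ≤ c.length := by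
    filter_upwards [Ioc_mem_nhdsGT c.length_pos] with t ht using ht
  have h : (fun p : ℝ × ℝ => compAngle x (c.toFun p.1) (c.toFun p.2))
      =ᶠ[𝓝[>] 0 ×ˢ 𝓝[>] 0] fun _ => 0 := by
    filter_upwards [hev.prod_mk hev] with p hp
    obtain ⟨⟨h1, h2⟩, h3, h4⟩ := hp
    unfold compAngle
    rw [dist_start c h1.le h2, dist_start c h3.le h4,
      c.isometric _ ⟨h1.le, h2⟩ _ ⟨h3.le, h4⟩, sq_abs]
    rw [show p.1 ^ 2 + p.2 ^ 2 - (p.1 - p.2) ^ 2 = 2 * p.1 * p.2 by ring,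
      div_self (by positivity), Real.arccos_one]
  unfold gAngle
  rw [limsup_congr h, limsup_const]

theorem gAngle_comm (c c' : GeodesicFrom x) : gAngle c c' = gAngle c' c := by
  have h : (fun p : ℝ × ℝ => compAngle x (c.toFun p.1) (c'.toFun p.2))
      = (fun p : ℝ × ℝ => compAngle x (c'.toFun p.1) (c.toFun p.2)) ∘ Prod.swap := by
    funext p
    exact compAngle_comm _ _ _
  unfold gAngle
  rw [h, limsup, ← map_map, ← prod_comm, limsup]

/-- The law of cosines. -/
def cosSide (s t α : ℝ) : ℝ := Real.sqrt (s ^ 2 + t ^ 2 - 2 * s * t * Real.cos α)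

theorem exists_point_on_side {a b α β : ℝ} (ha : 0 < a) (hb : 0 < b) (hα : 0 < α) (hβ : 0 < β)
    (h : α + β < Real.pi) :
    ∃ t, 0 < t ∧ t ≤ max a b ∧ cosSide a t α + cosSide t b β = cosSide a b (α + β) := by
  have s1 : 0 < Real.sin α := Real.sin_pos_of_pos_of_lt_pi hα (by linarith)
  have s2 : 0 < Real.sin β := Real.sin_pos_of_pos_of_lt_pi hβ (by linarith)
  have s3 : 0 < Real.sin (α + β) := Real.sin_pos_of_pos_of_lt_pi (by linarith) h
  have hD : 0 < a * Real.sin α + b * Real.sin β := by positivity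
  set D := a * Real.sin α + b * Real.sin β with hDdef
  have e1 := Real.sin_sq_add_cos_sq α
  have e2 := Real.sin_sq_add_cos_sq β
  obtain ⟨l, hl⟩ : ∃ l, l = b * Real.sin β / D := ⟨_, rfl⟩
  obtain ⟨m, hm⟩ : ∃ m, m = a * Real.sin α / D := ⟨_, rfl⟩
  have hl0 : 0 ≤ l := by rw [hl]; positivity
  have hm0 : 0 ≤ m := by rw [hm]; positivity
  have hlm : l + m = 1 := by
    rw [hl, hm, ← add_div, add_comm, ← hDdef, div_self hD.ne']
  have hbal : l * (a * Real.sin α) = m * (b * Real.sin β) := by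
    rw [hl, hm]; ring
  have ht : a * b * Real.sin (α + β) / D = l * (a * Real.cos α) + m * (b * Real.cos β) := by
    rw [hl, hm, Real.sin_add]; ring
  have hl1 : l = 1 - m := by linarith
  set L := a ^ 2 + b ^ 2 - 2 * a * b * Real.cos (α + β) with hL
  have hL' : L = (a * Real.cos α - b * Real.cos β) ^ 2
      + (a * Real.sin α + b * Real.sin β) ^ 2 := by
    rw [hL, Real.cos_add]
    linear_combination (-a ^ 2) * e1 + (-b ^ 2) * e2
  have hL0 : 0 ≤ L := by rw [hL']; positivity
  refine ⟨a * b * Real.sin (α + β) / D, by positivity, ?_, ?_⟩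
  · rw [ht]
    have c1 : a * Real.cos α ≤ max a b :=
      (mul_le_of_le_one_right ha.le (Real.cos_le_one _)).trans (le_max_left _ _)
    have c2 : b * Real.cos β ≤ max a b :=
      (mul_le_of_le_one_right hb.le (Real.cos_le_one _)).trans (le_max_right _ _)
    calc l * (a * Real.cos α) + m * (b * Real.cos β) ≤ l * max a b + m * max a b := by gcongr
      _ = max a b := by rw [← add_mul, hlm, one_mul]
  · rw [ht]
    set t := l * (a * Real.cos α) + m * (b * Real.cos β) with htd
    have k1 : a ^ 2 + t ^ 2 - 2 * a * t * Real.cos α = m ^ 2 * L := by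
      have x1 : a * Real.cos α - t = m * (a * Real.cos α - b * Real.cos β) := by
        rw [htd, hl1]; ring
      have x2 : a * Real.sin α = m * (a * Real.sin α + b * Real.sin β) := by
        rw [mul_add, ← hbal, hl1]; ring
      have : a ^ 2 + t ^ 2 - 2 * a * t * Real.cos α
          = (a * Real.cos α - t) ^ 2 + (a * Real.sin α) ^ 2 := by
        linear_combination (-a ^ 2) * e1
      rw [this, x1, hL']
      linear_combination
        (a * Real.sin α + m * (a * Real.sin α + b * Real.sin β)) * x2
    have k2 : t ^ 2 + b ^ 2 - 2 * t * b * Real.cos β = l ^ 2 * L := by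
      have x1 : b * Real.cos β - t = l * (b * Real.cos β - a * Real.cos α) := by
        rw [htd]; have : m = 1 - l := by linarith
        rw [this]; ring
      have x2 : b * Real.sin β = l * (a * Real.sin α + b * Real.sin β) := by
        rw [mul_add, hbal, hl1]; ring
      have : t ^ 2 + b ^ 2 - 2 * t * b * Real.cos β
          = (b * Real.cos β - t) ^ 2 + (b * Real.sin β) ^ 2 := by
        linear_combination (-b ^ 2) * e2
      rw [this, x1, hL']
      linear_combination
        (b * Real.sin β + l * (a * Real.sin α + b * Real.sin β)) * x2
    unfold cosSide
    rw [k1, k2, ← hL, Real.sqrt_mul (sq_nonneg m), Real.sqrt_mul (sq_nonneg l),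
      Real.sqrt_sq hm0, Real.sqrt_sq hl0, ← add_mul, add_comm m, hlm, one_mul]

theorem cosArg_mem (p a b : M) (ha : 0 < dist p a) (hb : 0 < dist p b) :
    -1 ≤ (dist p a ^ 2 + dist p b ^ 2 - dist a b ^ 2) / (2 * dist p a * dist p b) ∧
    (dist p a ^ 2 + dist p b ^ 2 - dist a b ^ 2) / (2 * dist p a * dist p b) ≤ 1 := by
  have hpos : 0 < 2 * dist p a * dist p b := by positivity
  have t1 := dist_triangle_left a b p
  have t2 := dist_triangle p a b
  have t3 := dist_triangle_right p a b
  rw [le_div_iff₀ hpos, div_le_iff₀ hpos]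
  have h0 : 0 ≤ dist a b := dist_nonneg
  constructor
  · nlinarith
  · nlinarith [abs_le.2 (⟨by linarith, by linarith⟩ :
      -(dist a b) ≤ dist p a - dist p b ∧ dist p a - dist p b ≤ dist a b),
      sq_le_sq' (by linarith : -(dist a b) ≤ dist p a - dist p b) (by linarith)]

theorem dist_lt_cosSide {p a b : M} {α : ℝ} (ha : 0 < dist p a) (hb : 0 < dist p b)
    (hα : α ≤ Real.pi) (h : compAngle p a b < α) :
    dist a b < cosSide (dist p a) (dist p b) α := by
  have hpos : 0 < 2 * dist p a * dist p b := by positivity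
  obtain ⟨m1, m2⟩ := cosArg_mem p a b ha hb
  have hc := Real.cos_lt_cos_of_nonneg_of_le_pi (compAngle_nonneg p a b) hα h
  rw [compAngle, Real.cos_arccos m1 m2, lt_div_iff₀ hpos] at hc
  apply Real.lt_sqrt_of_sq_lt
  linarith

theorem cosSide_lt_dist {p a b : M} {α : ℝ} (ha : 0 < dist p a) (hb : 0 < dist p b)
    (hα : 0 ≤ α) (h : α < compAngle p a b) :
    cosSide (dist p a) (dist p b) α < dist a b := by
  have hpos : 0 < 2 * dist p a * dist p b := by positivity
  obtain ⟨m1, m2⟩ := cosArg_mem p a b ha hb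
  have hc := Real.cos_lt_cos_of_nonneg_of_le_pi hα (compAngle_le_pi p a b) h
  rw [compAngle, Real.cos_arccos m1 m2, div_lt_iff₀ hpos] at hc
  have hne : 0 < dist a b := by
    refine lt_of_le_of_ne dist_nonneg fun h0 => ?_
    have t1 := dist_triangle p a b
    have t3 := dist_triangle_right p a b
    have e : dist p a = dist p b := by linarith
    rw [← h0, e] at hc
    rw [e] at hpos
    nlinarith [Real.cos_le_one α]
  rw [cosSide, Real.sqrt_lt' hne]
  linarith

theorem gAngle_triangle (c₁ c c₂ : GeodesicFrom x) :
    gAngle c₁ c₂ ≤ gAngle c₁ c + gAngle c c₂ := by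
  by_contra! hlt
  obtain ⟨δ, hδ, hδ'⟩ : ∃ δ > 0, (gAngle c₁ c + δ) + (gAngle c c₂ + δ) < gAngle c₁ c₂ :=
    ⟨(gAngle c₁ c₂ - (gAngle c₁ c + gAngle c c₂)) / 3, by linarith, by linarith⟩
  have hα : 0 < gAngle c₁ c + δ := by linarith [gAngle_nonneg c₁ c]
  have hβ : 0 < gAngle c c₂ + δ := by linarith [gAngle_nonneg c c₂]
  set α := gAngle c₁ c + δ with hαd
  set β := gAngle c c₂ + δ with hβd
  have ev1 := eventually_lt_of_limsup_lt (show gAngle c₁ c < α by linarith)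
    (compAngle_bdd (fun p => (c₁.toFun p.1, c.toFun p.2)) _)
  have ev2 := eventually_lt_of_limsup_lt (show gAngle c c₂ < β by linarith)
    (compAngle_bdd (fun p => (c.toFun p.1, c₂.toFun p.2)) _)
  have fr := frequently_lt_of_lt_limsup
    (compAngle_cobdd (fun p => (c₁.toFun p.1, c₂.toFun p.2)) _) hδ'
  have hb := (nhdsGT_basis (0 : ℝ)).prod_self
  obtain ⟨ε₁, hε₁, H1⟩ := hb.eventually_iff.1 ev1
  obtain ⟨ε₂, hε₂, H2⟩ := hb.eventually_iff.1 ev2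
  obtain ⟨ε, hε, l1, l2, l3, l4, l5⟩ : ∃ ε > 0, ε ≤ ε₁ ∧ ε ≤ ε₂ ∧ ε ≤ c₁.length ∧
      ε ≤ c.length ∧ ε ≤ c₂.length := by
    refine ⟨min ε₁ (min ε₂ (min c₁.length (min c.length c₂.length))), ?_, ?_⟩
    · simp only [gt_iff_lt, lt_min_iff]
      exact ⟨hε₁, hε₂, c₁.length_pos, c.length_pos, c₂.length_pos⟩
    · simp
  obtain ⟨⟨s, r⟩, ⟨⟨hs0, hsε⟩, hr0, hrε⟩, hF⟩ := hb.frequently_iff.1 fr ε hε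
  dsimp only at hs0 hsε hr0 hrε hF
  have hpi : α + β < Real.pi := hF.trans_le (compAngle_le_pi _ _ _)
  obtain ⟨t, ht0, htm, hsum⟩ := exists_point_on_side hs0 hr0 hα hβ hpi
  have htε : t < ε := htm.trans_lt (max_lt hsε hrε)
  have K1 : compAngle x (c₁.toFun s) (c.toFun t) < α :=
    H1 (x := (s, t)) ⟨⟨hs0, hsε.trans_le l1⟩, ht0, htε.trans_le l1⟩
  have K2 : compAngle x (c.toFun t) (c₂.toFun r) < β :=
    H2 (x := (t, r)) ⟨⟨ht0, htε.trans_le l2⟩, hr0, hrε.trans_le l2⟩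
  have ds := dist_start c₁ hs0.le (hsε.le.trans l3)
  have dt := dist_start c ht0.le (htε.le.trans l4)
  have dr := dist_start c₂ hr0.le (hrε.le.trans l5)
  have I1 := dist_lt_cosSide (by rwa [ds]) (by rwa [dt]) (by linarith) K1
  have I2 := dist_lt_cosSide (by rwa [dt]) (by rwa [dr]) (by linarith) K2
  have I3 := cosSide_lt_dist (by rwa [ds]) (by rwa [dr]) (by linarith) hF
  rw [ds, dt] at I1
  rw [dt, dr] at I2
  rw [ds, dr] at I3
  have := dist_triangle (c₁.toFun s) (c.toFun t) (c₂.toFun r)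
  linarith

end angle

/-- Geodesics starting at `x`, with the angle as (pseudo-)distance. -/
instance {M : Type*} [PseudoMetricSpace M] (x : M) : PseudoMetricSpace (GeodesicFrom x) where
  dist := gAngle
  dist_self := gAngle_self
  dist_comm := gAngle_comm
  dist_triangle := gAngle_triangle

/-- The space of directions `Σₓ` at `x`: geodesics starting at `x`, identified if
their angle is zero, with the angle as metric. (For points of spherical buildings this space is
complete, so that it agrees with its completion.) -/
abbrev Directions {M : Type*} [PseudoMetricSpace M] (x : M) : Type _ :=
  SeparationQuotient (GeodesicFrom x)

/-- The set `ΣₓC` of directions at `x` of geodesics that start at `x` and run in `C`. -/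
def directionsOf {M : Type*} [PseudoMetricSpace M] (C : Set M) (x : M) : Set (Directions x) :=
  {v | ∃ c : GeodesicFrom x, (∀ t ∈ Set.Icc 0 c.length, c.toFun t ∈ C) ∧
    SeparationQuotient.mk c = v}

end SphBuild

end

/-!
A chart of `B` whose trace on `C` meets as many cells of the Weyl group arrangement as possible
contains `C`: a point of `C` outside it could be reached by a chart that agrees with the given one
where it meets `C`, because the germ of an apartment at a point `p` and an antipode of `p` span an
apartment. Applied to an isometrically embedded sphere, which is convex and spherical, this shows
that every subset isometric to `Sⁿ` is an apartment.

Now let `z` be the antipode of `x` in an apartment containing `C`. Every direction at `x` is that of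
a geodesic of length `π` from `x` to `z`, and any two such geodesics lie in a common apartment,
where the spherical law of cosines holds. Hence those with direction in `Aₓ` fill up a round
sphere, the suspension of `Aₓ`. It is therefore an apartment; it contains `C`, since a point of `C`
other than `x` and `z` lies on such a geodesic, with direction in `ΣₓC ⊆ Aₓ`.
-/

noncomputable section

namespace SphBuild

open InnerProductGeometry NormedSpace
open scoped Real RealInnerProductSpace

theorem ne_zero_of_norm_eq_one {V : Type*} [NormedAddCommGroup V] {x : V} (hx : ‖x‖ = 1) :
    x ≠ 0 :=
  norm_ne_zero_iff.1 (hx ▸ one_ne_zero)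

/-! ### Great circles and angles -/

section GreatCircle

variable {V : Type*} [NormedAddCommGroup V] [InnerProductSpace ℝ V]

/-- The vector `e` is a unit tangent vector at the point `u` of the unit sphere, that is, an initial
direction of a unit speed great circle through `u`. -/
structure IsUnitTangent (u e : V) : Prop where
  norm_left : ‖u‖ = 1
  norm_right : ‖e‖ = 1
  inner_eq_zero : ⟪u, e⟫ = 0

/-- The great circle that starts at `u` in the direction `e`, with unit speed if `e` is a
unit tangent vector at `u`. -/
def greatCircle (u e : V) (t : ℝ) : V := Real.cos t • u + Real.sin t • e

@[simp] theorem greatCircle_zero (u e : V) : greatCircle u e 0 = u := by simp [greatCircle]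

@[simp] theorem greatCircle_pi (u e : V) : greatCircle u e π = -u := by simp [greatCircle]

theorem continuous_greatCircle (u e : V) : Continuous (greatCircle u e) := by
  unfold greatCircle; fun_prop

theorem inner_greatCircle {u e e' : V} (h : IsUnitTangent u e) (h' : IsUnitTangent u e') (s t : ℝ) :
    ⟪greatCircle u e s, greatCircle u e' t⟫
      = Real.cos s * Real.cos t + Real.sin s * Real.sin t * ⟪e, e'⟫ := by
  have heu : ⟪e, u⟫ = 0 := (real_inner_comm _ _).trans h.inner_eq_zero
  simp only [greatCircle, inner_add_left, inner_add_right, real_inner_smul_left,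
    real_inner_smul_right, heu, h'.inner_eq_zero, real_inner_self_eq_norm_sq, h.norm_left]
  ring

theorem norm_greatCircle {u e : V} (h : IsUnitTangent u e) (t : ℝ) : ‖greatCircle u e t‖ = 1 := by
  rw [norm_eq_sqrt_real_inner, inner_greatCircle h h, real_inner_self_eq_norm_sq, h.norm_right,
    one_pow, mul_one, ← sq, ← sq, Real.cos_sq_add_sin_sq, Real.sqrt_one]

theorem angle_eq_of_inner_eq_cos {x y : V} (hx : ‖x‖ = 1) (hy : ‖y‖ = 1) {t : ℝ}
    (ht : t ∈ Set.Icc 0 π) (h : ⟪x, y⟫ = Real.cos t) : angle x y = t := by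
  rw [angle, hx, hy, h, mul_one, div_one, Real.arccos_cos ht.1 ht.2]

theorem angle_greatCircle {u e : V} (h : IsUnitTangent u e) {s t : ℝ} (hst : |s - t| ≤ π) :
    angle (greatCircle u e s) (greatCircle u e t) = |s - t| := by
  refine angle_eq_of_inner_eq_cos (norm_greatCircle h _) (norm_greatCircle h _)
    ⟨abs_nonneg _, hst⟩ ?_
  rw [inner_greatCircle h h, Real.cos_abs, Real.cos_sub, real_inner_self_eq_norm_sq, h.norm_right]
  ring

theorem angle_greatCircle_left {u e : V} (h : IsUnitTangent u e) {t : ℝ} (ht : t ∈ Set.Icc 0 π) :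
    angle u (greatCircle u e t) = t := by
  have := angle_greatCircle h (s := 0) (t := t) (by simpa [abs_of_nonneg ht.1] using ht.2)
  simpa [abs_of_nonneg ht.1] using this

theorem exists_eq_greatCircle {u y : V} (hu : ‖u‖ = 1) (hy : ‖y‖ = 1)
    (h : angle u y ∈ Set.Ioo 0 π) :
    ∃ e, IsUnitTangent u e ∧ y = greatCircle u e (angle u y) := by
  have hs : 0 < Real.sin (angle u y) := Real.sin_pos_of_mem_Ioo h
  have hc : ⟪u, y⟫ = Real.cos (angle u y) := inner_eq_cos_angle_of_norm_eq_one hu hy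
  set θ := angle u y
  have hnorm : ‖y - Real.cos θ • u‖ = Real.sin θ := by
    rw [← pow_left_inj₀ (norm_nonneg _) hs.le two_ne_zero, @norm_sub_sq_real, norm_smul,
      real_inner_smul_right, real_inner_comm, hc, hu, hy, Real.sin_sq, mul_one, Real.norm_eq_abs,
      sq_abs]
    ring
  refine ⟨(Real.sin θ)⁻¹ • (y - Real.cos θ • u), ⟨hu, ?_, ?_⟩, ?_⟩
  · rw [norm_smul, hnorm, norm_inv, Real.norm_of_nonneg hs.le, inv_mul_cancel₀ hs.ne']
  · rw [real_inner_smul_right, inner_sub_right, real_inner_smul_right, hc,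
      real_inner_self_eq_norm_sq, hu, one_pow, mul_one, sub_self, mul_zero]
  · rw [greatCircle, smul_smul, mul_inv_cancel₀ hs.ne', one_smul, add_sub_cancel]

theorem eq_neg_of_angle_eq_pi {u y : V} (hu : ‖u‖ = 1) (hy : ‖y‖ = 1) (h : angle u y = π) :
    y = -u := by
  have h0 : angle u (-y) = 0 := by rw [angle_neg_right, h, sub_self]
  rw [eq_of_angle_eq_zero_of_norm_eq h0 (by rw [hu, norm_neg, hy]), neg_neg]

theorem eq_or_eq_neg_or_exists_eq_greatCircle {u y : V} (hu : ‖u‖ = 1) (hy : ‖y‖ = 1) :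
    y = u ∨ y = -u ∨ ∃ e, IsUnitTangent u e ∧ ∃ t ∈ Set.Ioo 0 π, y = greatCircle u e t := by
  rcases (angle_nonneg u y).eq_or_lt with h0 | h0
  · exact Or.inl (eq_of_angle_eq_zero_of_norm_eq h0.symm (hu.trans hy.symm)).symm
  rcases (angle_le_pi u y).eq_or_lt with hpi | hpi
  · exact Or.inr (Or.inl (eq_neg_of_angle_eq_pi hu hy hpi))
  · obtain ⟨e, he, hy⟩ := exists_eq_greatCircle hu hy ⟨h0, hpi⟩
    exact Or.inr (Or.inr ⟨e, he, _, ⟨h0, hpi⟩, hy⟩)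

theorem angle_add_of_eq_add_smul {x y z : V} (hy : y ≠ 0) {a b : ℝ} (ha : 0 ≤ a) (hb : 0 ≤ b)
    (h : y = a • x + b • z) : angle x z = angle x y + angle y z := by
  refine angle_eq_angle_add_add_angle_add_of_mem_span hy (Submodule.mem_span_pair.2 ?_)
  exact ⟨⟨a, ha⟩, ⟨b, hb⟩, h.symm⟩

theorem sin_smul_normalize_of_angle_add {x m y : V} (hx : x ≠ 0) (hm : m ≠ 0) (hy : y ≠ 0)
    (h : angle x y = angle x m + angle m y) :
    Real.sin (angle x m) • normalize y
      = Real.sin (angle x y) • normalize m - Real.sin (angle m y) • normalize x := by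
  have inner_norm {v w : V} (hv : v ≠ 0) (hw : w ≠ 0) :
      ⟪normalize v, normalize w⟫ = Real.cos (angle v w) := by
    rw [inner_eq_cos_angle_of_norm_eq_one (norm_normalize_eq_one_iff.2 hv)
      (norm_normalize_eq_one_iff.2 hw), angle_normalize_left, angle_normalize_right]
  rw [← sub_eq_zero, ← inner_self_eq_zero (𝕜 := ℝ)]
  simp only [inner_sub_left, inner_sub_right, real_inner_smul_left, real_inner_smul_right,
    inner_norm hx hm, inner_norm hm hy, inner_norm hx hy, inner_norm hm hx, inner_norm hy hm,
    inner_norm hy hx, inner_norm hx hx, inner_norm hm hm, inner_norm hy hy, angle_self hx,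
    angle_self hm, angle_self hy, angle_comm m x, angle_comm y m, angle_comm y x, h, Real.cos_zero]
  rw [Real.sin_add, Real.cos_add]
  have e1 := Real.cos_sq' (angle x m)
  have e2 := Real.cos_sq' (angle m y)
  ring_nf
  simp only [e1, e2]
  ring

theorem sin_mul_cos_angle_of_angle_add {x m y : V} (hx : x ≠ 0) (hm : m ≠ 0) (hy : y ≠ 0)
    (h : angle x y = angle x m + angle m y) {z : V} (hz : z ≠ 0) :
    Real.sin (angle x m) * Real.cos (angle z y)
      = Real.sin (angle x y) * Real.cos (angle z m)
        - Real.sin (angle m y) * Real.cos (angle z x) := by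
  have cos_eq {v : V} (hv : v ≠ 0) : Real.cos (angle z v) = ⟪normalize z, normalize v⟫ := by
    rw [inner_eq_cos_angle_of_norm_eq_one (norm_normalize_eq_one_iff.2 hz)
      (norm_normalize_eq_one_iff.2 hv), angle_normalize_left, angle_normalize_right]
  simp only [cos_eq hx, cos_eq hm, cos_eq hy, ← real_inner_smul_right, ← inner_sub_right,
    sin_smul_normalize_of_angle_add hx hm hy h]

theorem angle_eq_of_angle_add {V' : Type*} [NormedAddCommGroup V'] [InnerProductSpace ℝ V']
    {x m y z : V} {x' m' y' z' : V'} (hx : x ≠ 0) (hm : m ≠ 0) (hy : y ≠ 0) (hz : z ≠ 0)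
    (hx' : x' ≠ 0) (hm' : m' ≠ 0) (hy' : y' ≠ 0) (hz' : z' ≠ 0)
    (h : angle x y = angle x m + angle m y) (hpos : angle x m ∈ Set.Ioo 0 π)
    (hxm : angle x' m' = angle x m) (hmy : angle m' y' = angle m y) (hxy : angle x' y' = angle x y)
    (hzx : angle z' x' = angle z x) (hzm : angle z' m' = angle z m) : angle z' y' = angle z y := by
  have key := sin_mul_cos_angle_of_angle_add hx hm hy h hz
  have key' := sin_mul_cos_angle_of_angle_add hx' hm' hy' (by rw [hxy, h, hxm, hmy]) hz'
  rw [hxm, hxy, hmy, hzx, hzm, ← key] at key'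
  exact Real.injOn_cos ⟨angle_nonneg _ _, angle_le_pi _ _⟩ ⟨angle_nonneg _ _, angle_le_pi _ _⟩
    (mul_left_cancel₀ (Real.sin_pos_of_mem_Ioo hpos).ne' key')

end GreatCircle

/-! ### CAT(1) spaces -/

section CAT1

theorem exists_isUnitTangent_inner_eq_cos (θ : ℝ) :
    ∃ u e f : E 3, IsUnitTangent u e ∧ IsUnitTangent u f ∧ ⟪e, f⟫ = Real.cos θ := by
  let b := EuclideanSpace.basisFun (Fin 3) ℝ
  have hb (i j : Fin 3) (hij : i ≠ j) : IsUnitTangent (b i) (b j) :=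
    ⟨b.norm_eq_one i, b.norm_eq_one j, b.inner_eq_zero hij⟩
  have h12 := hb 1 2 (by decide)
  refine ⟨b 0, b 1, greatCircle (b 1) (b 2) θ, hb 0 1 (by decide),
    ⟨b.norm_eq_one 0, norm_greatCircle h12 θ, ?_⟩, ?_⟩
  · rw [greatCircle, inner_add_right, real_inner_smul_right, real_inner_smul_right,
      b.inner_eq_zero (by decide), b.inner_eq_zero (by decide), mul_zero, mul_zero, add_zero]
  · simpa using inner_greatCircle h12 h12 0 θ

theorem exists_spherical_angle {α β γ : ℝ} (hα : α ≤ β + γ) (hβ : β ≤ α + γ) (hγ : γ ≤ α + β)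
    (hper : α + β + γ ≤ 2 * π) :
    ∃ θ, Real.cos α * Real.cos γ + Real.sin α * Real.sin γ * Real.cos θ = Real.cos β := by
  have hsub : Real.cos β ≤ Real.cos (α - γ) := by
    rw [← Real.cos_abs (α - γ)]
    exact Real.cos_le_cos_of_nonneg_of_le_pi (abs_nonneg _) (by linarith)
      (abs_le.2 ⟨by linarith, by linarith⟩)
  have hadd : Real.cos (α + γ) ≤ Real.cos β := by
    rcases le_total (α + γ) π with h | h
    · exact Real.cos_le_cos_of_nonneg_of_le_pi (by linarith) h hβ
    · rw [← Real.cos_two_pi_sub (α + γ)]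
      exact Real.cos_le_cos_of_nonneg_of_le_pi (by linarith) (by linarith) (by linarith)
  rw [Real.cos_sub] at hsub
  rw [Real.cos_add] at hadd
  have hcont : ContinuousOn
      (fun θ => Real.cos α * Real.cos γ + Real.sin α * Real.sin γ * Real.cos θ) (Set.Icc 0 π) := by
    fun_prop
  obtain ⟨θ, -, hθ⟩ := intermediate_value_Icc' Real.pi_pos.le hcont
    (show Real.cos β ∈ Set.Icc _ _ by
      simp only [Real.cos_pi, Real.cos_zero]
      constructor <;> linarith)
  exact ⟨θ, hθ⟩

theorem exists_comparison_triangle {α β γ s : ℝ} (hα : α ≤ β + γ) (hβ : β ≤ α + γ)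
    (hγ : γ ≤ α + β) (hper : α + β + γ < 2 * π) (hs : s ∈ Set.Icc 0 α) :
    ∃ m p r a : USphere 3, angDist m p = α ∧ angDist p r = β ∧ angDist m r = γ ∧
      angDist m a = s ∧ angDist a p = α - s := by
  obtain ⟨θ, hθ⟩ := exists_spherical_angle hα hβ hγ hper.le
  obtain ⟨u, e, f, he, hf, hef⟩ := exists_isUnitTangent_inner_eq_cos θ
  have hαI : α ∈ Set.Icc 0 π := ⟨by linarith, by linarith⟩
  have hsπ : s ≤ π := hs.2.trans hαI.2
  have mem {x : E 3} (hx : ‖x‖ = 1) : x ∈ sphere (0 : E 3) 1 := mem_sphere_zero_iff_norm.2 hx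
  refine ⟨⟨u, mem he.norm_left⟩, ⟨_, mem (norm_greatCircle he α)⟩, ⟨_, mem (norm_greatCircle hf γ)⟩,
    ⟨_, mem (norm_greatCircle he s)⟩, angle_greatCircle_left he hαI, ?_,
    angle_greatCircle_left hf ⟨by linarith, by linarith⟩, angle_greatCircle_left he ⟨hs.1, hsπ⟩, ?_⟩
  · exact angle_eq_of_inner_eq_cos (norm_greatCircle he α) (norm_greatCircle hf γ)
      ⟨by linarith, by linarith⟩ (by rw [inner_greatCircle he hf, hef, hθ])
  · have habs : |s - α| = α - s := by rw [abs_sub_comm, abs_of_nonneg (sub_nonneg.2 hs.2)]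
    exact (angle_greatCircle he (by rw [habs]; linarith [hs.1, hαI.2])).trans habs

theorem Between.symm {M : Type*} [PseudoMetricSpace M] {a z b : M} (h : Between a z b) :
    Between b z a := by
  unfold Between at *
  rw [dist_comm b z, dist_comm z a, dist_comm b a, ← h, add_comm]

variable {M : Type*} [MetricSpace M]

theorem USphere.ne_zero {d : ℕ} (u : USphere d) : (u : E d) ≠ 0 :=
  ne_zero_of_norm_eq_one (norm_eq_of_mem_sphere u)

theorem IsCAT1.exists_vertex_comparison (hM : IsCAT1 M) {m p r a : M}
    (hper : dist m p + dist p r + dist r m < 2 * π) (ha : Between m a p) :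
    ∃ m' p' r' a' : USphere 3, angDist m' p' = dist m p ∧ angDist m' r' = dist m r ∧
      angDist m' a' = dist m a ∧ angDist a' p' = dist a p ∧
      angDist p' r' = dist p r ∧ dist a r ≤ angDist a' r' := by
  have ha' : dist m a + dist a p = dist m p := ha
  have hap : dist m p - dist m a = dist a p := by linarith
  obtain ⟨m', p', r', a', hmp, hpr, hmr, hma, hap'⟩ :=
    exists_comparison_triangle (α := dist m p) (β := dist p r) (γ := dist m r) (s := dist m a)
      (by linarith [dist_triangle m r p, dist_comm r p])
      (by linarith [dist_triangle p m r, dist_comm m p])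
      (dist_triangle m p r) (by rwa [dist_comm m r])
      ⟨dist_nonneg, by linarith [dist_nonneg (x := a) (y := p)]⟩
  rw [hap] at hap'
  refine ⟨m', p', r', a', hmp, hmr, hma, hap', hpr, ?_⟩
  exact hM.comparison m p r a r hper ha (by rw [Between, dist_self, add_zero]) m' p' r' a' r'
    hmp hpr ((angle_comm _ _).trans (hmr.trans (dist_comm _ _))) hma hap' hmr
    (by rw [dist_self]; exact angle_self r'.ne_zero)

theorem IsCAT1.eq_of_between (hM : IsCAT1 M) {p q a b : M} (h : dist p q < π)
    (ha : Between p a q) (hb : Between p b q) (hab : dist p a = dist p b) : a = b := by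
  have ha' : dist p a + dist a q = dist p q := ha
  have haq : dist p q - dist p a = dist a q := by linarith
  have hbq : dist a q = dist b q := by unfold Between at ha hb; linarith
  obtain ⟨p', q', -, a', hpq, -, -, hpa, haq'⟩ :=
    exists_comparison_triangle (α := dist p q) (β := 0) (γ := dist p q) (s := dist p a)
      (by linarith) (by linarith [dist_nonneg (x := p) (y := q)]) (by linarith) (by linarith)
      ⟨dist_nonneg, by linarith [dist_nonneg (x := a) (y := q)]⟩
  rw [haq] at haq'
  have hle := hM.comparison p q q a b (by rw [dist_self, dist_comm q p]; linarith) ha hb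
    p' q' q' a' a' hpq (by rw [dist_self]; exact angle_self q'.ne_zero)
    ((angle_comm _ _).trans (hpq.trans (dist_comm _ _))) hpa haq' (hpa.trans hab) (haq'.trans hbq)
  exact dist_le_zero.1 (hle.trans (angle_self a'.ne_zero).le)

theorem IsCAT1.between_of_between (hM : IsCAT1 M) {p a m r : M} (hpam : Between p a m)
    (hamr : Between a m r) (ham : a ≠ m) (hpi : dist p m + dist m r ≤ π) : Between p m r := by
  by_contra hne
  have hlt : dist p r < dist p m + dist m r := lt_of_le_of_ne (dist_triangle _ _ _) (Ne.symm hne)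
  have hmr : 0 < dist m r := dist_pos.2 fun h => hne (by rw [h, Between, dist_self, add_zero])
  have hδ : 0 ≤ dist p a := dist_nonneg
  have hα : 0 < dist a m := dist_pos.2 ham
  obtain ⟨m', p', r', a', imp, imr, ima, iap, ipr, hcomp⟩ := hM.exists_vertex_comparison
    (by rw [dist_comm r m, dist_comm m p]; linarith) hpam.symm
  simp only [Between] at hpam hamr
  rw [dist_comm m p] at imp
  rw [dist_comm m a] at ima
  rw [dist_comm a p] at iap
  have iam : angDist a' m' = dist a m := (angle_comm _ _).trans ima
  have iar : angDist a' r' = dist a m + dist m r :=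
    ((angle_le_angle_add_angle _ (m' : E 3) _).trans_eq (congr_arg₂ _ iam imr)).antisymm
      (hamr.trans_le hcomp)
  have key := sin_mul_cos_angle_of_angle_add a'.ne_zero m'.ne_zero r'.ne_zero
    (show angle (a' : E 3) r' = angle (a' : E 3) m' + angle (m' : E 3) r' from
      iar.trans (congr_arg₂ _ iam imr).symm) p'.ne_zero
  simp only [angDist] at iam iar imr imp iap ipr
  rw [iam, iar, imr, angle_comm (p' : E 3) m', imp, angle_comm (p' : E 3) a', iap, ipr, ← hpam]
    at key
  have trig (α β δ : ℝ) : Real.sin (α + β) * Real.cos (δ + α) - Real.sin β * Real.cos δ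
      = Real.sin α * Real.cos (δ + α + β) := by
    rw [Real.cos_add (δ + α) β, Real.cos_add, Real.sin_add, Real.sin_add δ α]
    linear_combination (Real.sin β * Real.cos δ) * Real.sin_sq_add_cos_sq α
  rw [trig] at key
  have hcos := mul_left_cancel₀ (Real.sin_pos_of_pos_of_lt_pi hα (by linarith)).ne' key
  have := Real.injOn_cos ⟨dist_nonneg, by linarith⟩ ⟨by positivity, by linarith⟩ hcos
  linarith

end CAT1

/-! ### Charts of a spherical building -/

theorem exists_eq_smul_sphere {d : ℕ} {x : E d} (hx : x ≠ 0) :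
    ∃ (u : USphere d) (r : ℝ), 0 < r ∧ x = r • (u : E d) :=
  ⟨⟨normalize x, mem_sphere_zero_iff_norm.2 (norm_normalize_eq_one_iff.2 hx)⟩, ‖x‖,
    norm_pos_iff.2 hx, (norm_smul_normalize x).symm⟩

namespace SphericalBuilding

variable {n : ℕ} {B : Type*} [MetricSpace B] {X : SphericalBuilding n B}

/-- A chart, extended to the nonzero vectors by radial projection to the unit sphere, so that the
linear structure can be used to describe geodesics and the Weyl group. The value at `0` is
arbitrary. -/
def IsConeChart (X : SphericalBuilding n B) (k : E (n + 1) → B) : Prop :=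
  ∃ ι ∈ X.charts, ∀ (u : USphere (n + 1)) (r : ℝ), 0 < r → k (r • (u : E (n + 1))) = ι u

theorem exists_isConeChart {ι : USphere (n + 1) → B} (hι : ι ∈ X.charts) :
    ∃ k, X.IsConeChart k ∧ ∀ u : USphere (n + 1), k u = ι u := by
  let Φ := (homeomorphUnitSphereProd (E (n + 1))).symm
  have hΦ : Function.Injective fun p => (Φ p : E (n + 1)) := Subtype.val_injective.comp Φ.injective
  let k := Function.extend (fun p => (Φ p : E (n + 1))) (ι ∘ Prod.fst)
    fun _ => ι ⟨EuclideanSpace.single 0 1, by simp⟩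
  have hk (u : USphere (n + 1)) (r : ℝ) (hr : 0 < r) : k (r • (u : E (n + 1))) = ι u :=
    hΦ.extend_apply (ι ∘ Prod.fst) _ (u, ⟨r, hr⟩)
  exact ⟨k, ⟨ι, hι, hk⟩, fun u => by simpa using hk u 1 one_pos⟩

namespace IsConeChart

theorem dist_eq {k : E (n + 1) → B} (hk : X.IsConeChart k) {x y : E (n + 1)} (hx : x ≠ 0)
    (hy : y ≠ 0) : dist (k x) (k y) = angle x y := by
  obtain ⟨ι, hι, h⟩ := hk
  obtain ⟨u, r, hr, rfl⟩ := exists_eq_smul_sphere hx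
  obtain ⟨v, s, hs, rfl⟩ := exists_eq_smul_sphere hy
  rw [h u r hr, h v s hs, X.isometric ι hι, angDist, angle_smul_left_of_pos _ _ hr,
    angle_smul_right_of_pos _ _ hs]

theorem apply_smul {k : E (n + 1) → B} (hk : X.IsConeChart k) {x : E (n + 1)} (hx : x ≠ 0)
    {r : ℝ} (hr : 0 < r) : k (r • x) = k x := by
  rw [← dist_eq_zero, hk.dist_eq (smul_ne_zero hr.ne' hx) hx, angle_smul_left_of_pos _ _ hr,
    angle_self hx]

theorem apply_normalize {k : E (n + 1) → B} (hk : X.IsConeChart k) {x : E (n + 1)} (hx : x ≠ 0) :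
    k (normalize x) = k x :=
  hk.apply_smul hx (inv_pos.2 (norm_pos_iff.2 hx))

theorem continuousAt {k : E (n + 1) → B} (hk : X.IsConeChart k) {x : E (n + 1)} (hx : x ≠ 0) :
    ContinuousAt k x := by
  have hangle : Tendsto (fun y => angle y x) (𝓝 x) (𝓝 (angle x x)) :=
    (continuousAt_angle hx hx).comp (f := fun y => (y, x)) (by fun_prop)
  rw [angle_self hx] at hangle
  refine tendsto_iff_dist_tendsto_zero.2 (hangle.congr' ?_)
  filter_upwards [isOpen_ne.mem_nhds hx] with y hy
  rw [hk.dist_eq hy hx]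

theorem comp {k : E (n + 1) → B} (hk : X.IsConeChart k) {w : E (n + 1) ≃ₗᵢ[ℝ] E (n + 1)}
    (hw : w ∈ X.W) : X.IsConeChart (k ∘ w) := by
  obtain ⟨ι, hι, h⟩ := hk
  refine ⟨ι ∘ sphereMap w, X.comp_mem ι hι w hw, fun u r hr => ?_⟩
  rw [Function.comp_apply, map_smul]
  exact h (sphereMap w u) r hr

theorem exists_mem_W {k₁ k₂ : E (n + 1) → B} (h₁ : X.IsConeChart k₁) (h₂ : X.IsConeChart k₂) :
    ∃ w ∈ X.W, ∀ x y, ‖x‖ = ‖y‖ → k₁ x = k₂ y → x = w y := by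
  obtain ⟨ι₁, hι₁, h₁⟩ := h₁
  obtain ⟨ι₂, hι₂, h₂⟩ := h₂
  obtain ⟨w, hw, hcompat⟩ := X.compatible ι₁ hι₁ ι₂ hι₂
  refine ⟨w, hw, fun x y hxy h => ?_⟩
  rcases eq_or_ne x 0 with rfl | hx
  · rw [norm_eq_zero.1 (hxy.symm.trans norm_zero), map_zero]
  have hy : y ≠ 0 := norm_ne_zero_iff.1 (hxy ▸ norm_ne_zero_iff.2 hx)
  obtain ⟨u, r, hr, rfl⟩ := exists_eq_smul_sphere hx
  obtain ⟨v, s, hs, rfl⟩ := exists_eq_smul_sphere hy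
  have hrs : r = s := by
    simpa [norm_smul, norm_eq_of_mem_sphere, abs_of_pos hr, abs_of_pos hs] using hxy
  rw [h₁ u r hr, h₂ v s hs] at h
  rw [map_smul, hrs, hcompat u v h, sphereMap]

end IsConeChart

theorem exists_isConeChart_pair (X : SphericalBuilding n B) (a b : B) :
    ∃ k, X.IsConeChart k ∧ ∃ x y, ‖x‖ = 1 ∧ ‖y‖ = 1 ∧ k x = a ∧ k y = b := by
  obtain ⟨ι, hι, ⟨u, rfl⟩, ⟨v, rfl⟩⟩ := X.plenty a b
  obtain ⟨k, hk, h⟩ := exists_isConeChart hι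
  exact ⟨k, hk, u, v, norm_eq_of_mem_sphere u, norm_eq_of_mem_sphere v, h u, h v⟩

theorem dist_le_pi (X : SphericalBuilding n B) (a b : B) : dist a b ≤ π := by
  obtain ⟨k, hk, x, y, hx, hy, rfl, rfl⟩ := X.exists_isConeChart_pair a b
  rw [hk.dist_eq (ne_zero_of_norm_eq_one hx) (ne_zero_of_norm_eq_one hy)]
  exact angle_le_pi _ _

namespace IsConeChart

theorem exists_through {k : E (n + 1) → B} (hk : X.IsConeChart k) {x : E (n + 1)} (hx : x ≠ 0)
    (b : B) : ∃ k', X.IsConeChart k' ∧ k' x = k x ∧ ∃ y, ‖y‖ = 1 ∧ k' y = b := by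
  obtain ⟨k₁, hk₁, x', y, hx', hy, hx'x, hyb⟩ := X.exists_isConeChart_pair (k x) b
  obtain ⟨w, hw, hw_eq⟩ := hk₁.exists_mem_W hk
  have hk₁x : k₁ (‖x‖ • x') = k x := by
    rw [hk₁.apply_smul (ne_zero_of_norm_eq_one hx') (norm_pos_iff.2 hx), hx'x]
  have hwx : ‖x‖ • x' = w x := hw_eq _ _ (by rw [norm_smul, hx', norm_norm, mul_one]) hk₁x
  refine ⟨k₁ ∘ w, hk₁.comp hw, ?_, w.symm y, by rw [LinearIsometryEquiv.norm_map, hy], ?_⟩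
  · rw [Function.comp_apply, ← hwx, hk₁x]
  · rw [Function.comp_apply, LinearIsometryEquiv.apply_symm_apply, hyb]

theorem map_neg_eq {k : E (n + 1) → B} (hk : X.IsConeChart k) {x y : E (n + 1)} (hx : x ≠ 0)
    (hy : y ≠ 0) (h : dist (k x) (k y) = π) : k (-x) = k y := by
  rw [hk.dist_eq hx hy] at h
  obtain ⟨-, r, hr, rfl⟩ := angle_eq_pi_iff.1 h
  rw [← hk.apply_smul (neg_ne_zero.2 hx) (neg_pos.2 hr), neg_smul_neg]

theorem exists_through_antipode {k : E (n + 1) → B} (hk : X.IsConeChart k) {x : E (n + 1)}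
    (hx : x ≠ 0) {b : B} (h : dist (k x) b = π) :
    ∃ k', X.IsConeChart k' ∧ k' x = k x ∧ k' (-x) = b := by
  obtain ⟨k', hk', hx', y, hy, rfl⟩ := hk.exists_through hx b
  exact ⟨k', hk', hx', hk'.map_neg_eq hx (ne_zero_of_norm_eq_one hy) (by rw [hx', h])⟩

theorem between {k : E (n + 1) → B} (hk : X.IsConeChart k) {x y z : E (n + 1)} (hx : x ≠ 0)
    (hy : y ≠ 0) (hz : z ≠ 0) {a b : ℝ} (ha : 0 ≤ a) (hb : 0 ≤ b) (h : y = a • x + b • z) :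
    Between (k x) (k y) (k z) := by
  rw [Between, hk.dist_eq hx hy, hk.dist_eq hy hz, hk.dist_eq hx hz,
    angle_add_of_eq_add_smul hy ha hb h]

theorem eq_of_eq_add_smul {k₁ k₂ : E (n + 1) → B} (h₁ : X.IsConeChart k₁) (h₂ : X.IsConeChart k₂)
    {x y z : E (n + 1)} (hx : x ≠ 0) (hy : y ≠ 0) (hz : z ≠ 0) (hkx : k₁ x = k₂ x)
    (hkz : k₁ z = k₂ z) {a b : ℝ} (ha : 0 ≤ a) (hb : 0 ≤ b) (h : y = a • x + b • z) :
    k₁ y = k₂ y := by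
  rcases (angle_le_pi x z).eq_or_lt with hpi | hlt
  · obtain ⟨-, r, hr, rfl⟩ := angle_eq_pi_iff.1 hpi
    have hyx : y = (a + b * r) • x := by rw [h, smul_smul, add_smul]
    rcases lt_trichotomy (a + b * r) 0 with hneg | h0 | hpos
    · have hyz : y = ((a + b * r) / r) • r • x := by rw [smul_smul, div_mul_cancel₀ _ hr.ne, hyx]
      have hpos : 0 < (a + b * r) / r := div_pos_of_neg_of_neg hneg hr
      rw [hyz, h₁.apply_smul hz hpos, h₂.apply_smul hz hpos, hkz]
    · exact absurd (by rw [hyx, h0, zero_smul]) hy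
    · rw [hyx, h₁.apply_smul hx hpos, h₂.apply_smul hx hpos, hkx]
  · refine X.cat1.eq_of_between (by rwa [h₁.dist_eq hx hz]) (h₁.between hx hy hz ha hb h) ?_ ?_
    · rw [hkx, hkz]
      exact h₂.between hx hy hz ha hb h
    · rw [h₁.dist_eq hx hy, hkx, h₂.dist_eq hx hy]

end IsConeChart

end SphericalBuilding

/-! ### Cells of a hyperplane arrangement -/

section cells

variable {ι V : Type*} [NormedAddCommGroup V] [NormedSpace ℝ V] {ℓ : ι → V →L[ℝ] ℝ} {p q : V}

/-- A family of linear functionals cuts the space into cells, on which the signs of the functionals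
are constant. The predicate says that `p` lies in the closure of the cell of `q`. -/
def IsFaceOf (ℓ : ι → V →L[ℝ] ℝ) (p q : V) : Prop :=
  ∀ j, ℓ j p ≠ 0 → 0 < ℓ j p * ℓ j q

namespace IsFaceOf

theorem apply_ne_zero (h : IsFaceOf ℓ p q) {j : ι} (hj : ℓ j p ≠ 0) : ℓ j q ≠ 0 :=
  right_ne_zero_of_mul (h j hj).ne'

theorem apply_eq_zero (h : IsFaceOf ℓ p q) {j : ι} (hj : ℓ j q = 0) : ℓ j p = 0 :=
  of_not_not fun hp => h.apply_ne_zero hp hj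

theorem neg (h : IsFaceOf ℓ p q) : IsFaceOf ℓ (-p) (-q) := fun j hj => by
  simpa only [map_neg, neg_mul_neg] using h j (by simpa only [map_neg, neg_ne_zero] using hj)

theorem add_smul (h : IsFaceOf ℓ p q) {a b : ℝ} (ha : 0 < a) (hb : 0 ≤ b) :
    IsFaceOf ℓ q (a • q + b • p) := fun j hj => by
  have hpq : 0 ≤ ℓ j q * ℓ j p := by
    rcases eq_or_ne (ℓ j p) 0 with hp | hp
    · rw [hp, mul_zero]
    · exact (mul_comm (ℓ j p) _ ▸ h j hp).le
  calc 0 < a * (ℓ j q * ℓ j q) + b * (ℓ j q * ℓ j p) :=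
        add_pos_of_pos_of_nonneg (mul_pos ha (mul_self_pos.2 hj)) (mul_nonneg hb hpq)
    _ = ℓ j q * ℓ j (a • q + b • p) := by
        simp only [map_add, map_smul, smul_eq_mul]
        ring

end IsFaceOf

theorem isFaceOf_of_sign_eq (h : ∀ j, SignType.sign (ℓ j p) = SignType.sign (ℓ j q)) :
    IsFaceOf ℓ p q := fun j hj => by
  rw [← sign_eq_one_iff, sign_mul, ← h j, ← sign_mul, sign_eq_one_iff]
  exact mul_self_pos.2 hj

theorem eventually_isFaceOf [Finite ι] (ℓ : ι → V →L[ℝ] ℝ) (p : V) :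
    ∀ᶠ q in 𝓝 p, IsFaceOf ℓ p q :=
  eventually_all.2 fun j => eventually_imp_distrib_left.2 fun hj =>
    (continuousAt_const.mul (ℓ j).continuous.continuousAt).eventually
      (lt_mem_nhds (mul_self_pos.2 hj))

theorem exists_regular_perturbation [Finite ι] (ℓ : ι → V →L[ℝ] ℝ) (p : V) :
    ∃ e, IsFaceOf ℓ p (p + e) ∧ IsFaceOf ℓ p (p - e) ∧ ∀ j, ℓ j ≠ 0 → ℓ j (p + e) ≠ 0 := by
  obtain ⟨e, he⟩ := Module.Dual.exists_forall_ne_zero_of_forall_exists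
    (fun j : {j // ℓ j ≠ 0} => (ℓ j).toLinearMap) fun j => DFunLike.ne_iff.1 j.2
  have hadd : Tendsto (fun s : ℝ => p + s • e) (𝓝[>] 0) (𝓝 p) :=
    tendsto_nhdsWithin_of_tendsto_nhds (Continuous.tendsto' (by fun_prop) _ _ (by simp))
  have hsub : Tendsto (fun s : ℝ => p - s • e) (𝓝[>] 0) (𝓝 p) :=
    tendsto_nhdsWithin_of_tendsto_nhds (Continuous.tendsto' (by fun_prop) _ _ (by simp))
  have hface := eventually_isFaceOf ℓ p
  obtain ⟨s, ⟨hs_add, hs_sub⟩, hs⟩ := (((hadd.eventually hface).and (hsub.eventually hface)).and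
    self_mem_nhdsWithin).exists
  refine ⟨s • e, hs_add, hs_sub, fun j hj => ?_⟩
  rcases eq_or_ne (ℓ j p) 0 with hp | hp
  · rw [map_add, hp, zero_add, map_smul]
    exact smul_ne_zero (ne_of_gt hs) (he ⟨j, hj⟩)
  · exact hs_add.apply_ne_zero hp

theorem exists_isFaceOf_symm [Finite ι] (ℓ : ι → V →L[ℝ] ℝ) {S : Set V} (hS : S.Nonempty) :
    ∃ p ∈ S, ∀ q ∈ S, IsFaceOf ℓ p q → IsFaceOf ℓ q p := by
  obtain ⟨p, hp, hmin⟩ := exists_minimalFor_of_wellFoundedLT (· ∈ S) (fun v => {j | ℓ j v = 0}) hS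
  refine ⟨p, hp, fun q hq hpq j hj => ?_⟩
  have hzero : {j | ℓ j p = 0} ⊆ {j | ℓ j q = 0} := hmin hq fun _ => hpq.apply_eq_zero
  rw [mul_comm]
  exact hpq j fun hpj => hj (hzero hpj)

end cells

namespace SphericalBuilding

variable {n : ℕ} {B : Type*} [MetricSpace B] {X : SphericalBuilding n B}

/-- The coordinates of `x` and of `w x - x` for `w` in the Weyl group. Their signs determine the
stabilizer of `x`; the resulting cells refine those of the Coxeter complex. -/
def cellFunctional (X : SphericalBuilding n B) :
    Option X.W × Fin (n + 1) → E (n + 1) →L[ℝ] ℝ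
  | (none, i) => EuclideanSpace.proj i
  | (some w, i) => (EuclideanSpace.proj i).comp
      (((w : E (n + 1) ≃ₗᵢ[ℝ] E (n + 1)) : E (n + 1) →L[ℝ] E (n + 1)) -
        ContinuousLinearMap.id ℝ (E (n + 1)))

instance : Finite X.W := X.isReflectionGroup.1

theorem apply_eq_self_iff_cellFunctional (w : X.W) (x : E (n + 1)) :
    (w : E (n + 1) ≃ₗᵢ[ℝ] E (n + 1)) x = x ↔ ∀ i, X.cellFunctional (some w, i) x = 0 := by
  rw [← sub_eq_zero, PiLp.ext_iff]
  exact Iff.rfl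

theorem apply_eq_self_of_isFaceOf {p q : E (n + 1)} (h : IsFaceOf X.cellFunctional p q)
    {w : E (n + 1) ≃ₗᵢ[ℝ] E (n + 1)} (hw : w ∈ X.W) (hq : w q = q) : w p = p :=
  (apply_eq_self_iff_cellFunctional ⟨w, hw⟩ p).2 fun i =>
    h.apply_eq_zero ((apply_eq_self_iff_cellFunctional ⟨w, hw⟩ q).1 hq i)

theorem ne_zero_of_isFaceOf {p q : E (n + 1)} (h : IsFaceOf X.cellFunctional p q) (hp : p ≠ 0) :
    q ≠ 0 := by
  rintro rfl
  refine hp (PiLp.ext fun i => ?_)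
  exact h.apply_eq_zero (j := (none, i)) (map_zero (X.cellFunctional (none, i)))

namespace IsConeChart

variable {k k₁ k₂ : E (n + 1) → B}

theorem exists_dist_eq_angle (h₁ : X.IsConeChart k₁) (h₂ : X.IsConeChart k₂) {z : E (n + 1)}
    (hz : z ≠ 0) : ∃ w ∈ X.W, dist (k₁ z) (k₂ z) = angle z (w z) := by
  obtain ⟨k₃, h₃, hk₃z, y, hy, hk₃y⟩ := h₁.exists_through hz (k₂ z)
  obtain ⟨w, hw, hw_eq⟩ := h₃.exists_mem_W h₂
  have hy0 := ne_zero_of_norm_eq_one hy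
  have hyz : ‖z‖ • y = w z := hw_eq _ _ (by rw [norm_smul, hy, norm_norm, mul_one])
    (by rw [h₃.apply_smul hy0 (norm_pos_iff.2 hz), hk₃y])
  refine ⟨w, hw, ?_⟩
  rw [← hyz, angle_smul_right_of_pos _ _ (norm_pos_iff.2 hz), ← h₃.dist_eq hz hy0, hk₃z, hk₃y]

theorem eventually_eq_of_fixed (h₁ : X.IsConeChart k₁) (h₂ : X.IsConeChart k₂) {m : E (n + 1)}
    (hm : m ≠ 0) (h : k₁ m = k₂ m) :
    ∀ᶠ z in 𝓝 m, (∀ w ∈ X.W, w m = m → w z = z) → k₁ z = k₂ z := by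
  -- An element that moves `m` displaces points near `m` by more than the two charts differ there.
  have hfar (w : X.W) : ∀ᶠ z in 𝓝 m, w.1 m ≠ m → dist (k₁ z) (k₂ z) < angle z (w.1 z) := by
    refine eventually_imp_distrib_left.2 fun hw => ?_
    have hdist : ContinuousAt (fun z => dist (k₁ z) (k₂ z)) m :=
      (h₁.continuousAt hm).dist (h₂.continuousAt hm)
    have hangle : ContinuousAt (fun z => angle z (w.1 z)) m :=
      (continuousAt_angle hm (by simpa using hm)).comp (f := fun z => (z, w.1 z)) (by fun_prop)
    refine hdist.eventually_lt hangle ?_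
    rw [h, dist_self]
    exact (angle_nonneg _ _).lt_of_ne' fun h0 =>
      hw (eq_of_angle_eq_zero_of_norm_eq h0 (by simp)).symm
  filter_upwards [eventually_all.2 hfar, isOpen_ne.mem_nhds hm] with z hz hz0 hfix
  obtain ⟨w, hw, hdist⟩ := h₁.exists_dist_eq_angle h₂ hz0
  have hwm : w m = m := of_not_not fun hwm => (hz ⟨w, hw⟩ hwm).ne hdist
  rw [← dist_eq_zero, hdist, hfix w hw hwm, angle_self hz0]

theorem eq_of_isFaceOf (h₁ : X.IsConeChart k₁) (h₂ : X.IsConeChart k₂) {p q : E (n + 1)}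
    (hp : p ≠ 0) (hpq : IsFaceOf X.cellFunctional p q) (h : k₁ q = k₂ q) : k₁ p = k₂ p := by
  let r : ℝ → E (n + 1) := fun t => (1 - t) • q + t • p
  have hr : Continuous r := by fun_prop
  have hqr (t : ℝ) (ht : t ∈ Set.Ico 0 1) : IsFaceOf X.cellFunctional q (r t) :=
    hpq.add_smul (sub_pos.2 ht.2) ht.1
  have hr0 (t : ℝ) (ht : t ∈ Set.Icc 0 1) : r t ≠ 0 := by
    rcases ht.2.eq_or_lt with rfl | ht1
    · simpa [r] using hp
    · exact ne_zero_of_isFaceOf (hqr t ⟨ht.1, ht1⟩) (ne_zero_of_isFaceOf hpq hp)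
  have hcont {k : E (n + 1) → B} (hk : X.IsConeChart k) : ContinuousOn (k ∘ r) (Set.Icc 0 1) :=
    fun t ht => ((hk.continuousAt (hr0 t ht)).comp hr.continuousAt).continuousWithinAt
  have hsub : Set.Icc (0 : ℝ) 1 ⊆ {t | (k₁ ∘ r) t = (k₂ ∘ r) t} := by
    refine IsClosed.Icc_subset_of_forall_mem_nhdsWithin ?_ (by simpa [r] using h) ?_
    · rw [Set.inter_comm]
      exact isClosed_Icc.isClosed_eq (hcont h₁) (hcont h₂)
    · rintro t ⟨ht, ht01⟩
      have hnear := h₁.eventually_eq_of_fixed h₂ (hr0 t ⟨ht01.1, ht01.2.le⟩) ht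
      refine mem_nhdsWithin_of_mem_nhds ?_
      filter_upwards [hr.continuousAt.eventually hnear] with s hs
      refine hs fun w hw hwt => ?_
      have hwq : w q = q := apply_eq_self_of_isFaceOf (hqr t ht01) hw hwt
      have hwp : w p = p := apply_eq_self_of_isFaceOf hpq hw hwq
      simp only [r, map_add, map_smul, hwq, hwp]
  simpa [r] using hsub (Set.right_mem_Icc.2 zero_le_one)

theorem eventuallyEq_of_regular (h₁ : X.IsConeChart k₁) (h₂ : X.IsConeChart k₂) {q : E (n + 1)}
    (hq : q ≠ 0) (hreg : ∀ j, X.cellFunctional j ≠ 0 → X.cellFunctional j q ≠ 0)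
    (h : k₁ q = k₂ q) : k₁ =ᶠ[𝓝 q] k₂ := by
  filter_upwards [eventually_isFaceOf X.cellFunctional q, isOpen_ne.mem_nhds hq] with z hqz hz
  refine h₁.eq_of_isFaceOf h₂ hz (fun j hj => ?_) h
  rw [mul_comm]
  exact hqz j (hreg j fun h0 => hj (by rw [h0, zero_apply]))

end IsConeChart

end SphericalBuilding

/-! ### Antipodes and germs of apartments -/

namespace SphericalBuilding.IsConeChart

variable {n : ℕ} {B : Type*} [MetricSpace B] {X : SphericalBuilding n B}

theorem dist_map_map_neg {k₁ k₂ : E (n + 1) → B} (h₁ : X.IsConeChart k₁) (h₂ : X.IsConeChart k₂)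
    {p q m : E (n + 1)} (hp : p ≠ 0) (hq : q ≠ 0) (hm : m ≠ 0) (hkp : k₁ p = k₂ p)
    (hkm : k₁ m = k₂ m) {a b : ℝ} (ha : 0 < a) (hb : 0 < b) (h : p = a • q + b • m) :
    dist (k₁ q) (k₂ (-q)) = π := by
  have hq' : -q ≠ 0 := neg_ne_zero.2 hq
  rcases eq_or_ne (k₁ p) (k₁ m) with hpm | hpm
  · have hangle : angle m p = 0 := by rw [← h₁.dist_eq hm hp, hpm, dist_self]
    obtain ⟨-, r, -, rfl⟩ := angle_eq_zero_iff.1 hangle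
    have hqm : q = ((r - b) / a) • m := by
      rw [div_eq_inv_mul, mul_smul, sub_smul, h, add_sub_cancel_right, inv_smul_smul₀ ha.ne']
    have hc : (r - b) / a ≠ 0 := fun h0 => hq (by rw [hqm, h0, zero_smul])
    have hkq : k₁ q = k₂ q ∨ k₁ (-q) = k₂ (-q) := by
      rcases hc.lt_or_gt with hneg | hpos
      · right
        rw [hqm, ← neg_smul, h₁.apply_smul hm (neg_pos.2 hneg), h₂.apply_smul hm (neg_pos.2 hneg),
          hkm]
      · left
        rw [hqm, h₁.apply_smul hm hpos, h₂.apply_smul hm hpos, hkm]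
    rcases hkq with hkq | hkq
    · rw [hkq, h₂.dist_eq hq hq', angle_self_neg_of_nonzero hq]
    · rw [← hkq, h₁.dist_eq hq hq', angle_self_neg_of_nonzero hq]
  · have hqpm : Between (k₁ q) (k₁ p) (k₁ m) := h₁.between hq hp hm ha.le hb.le h
    have hpmq : Between (k₁ p) (k₁ m) (k₂ (-q)) := by
      rw [hkp, hkm]
      refine h₂.between hp hm hq' (inv_pos.2 hb).le (div_pos ha hb).le ?_
      rw [h, smul_add, inv_smul_smul₀ hb.ne', smul_smul, ← div_eq_inv_mul]
      module
    have hsum : dist (k₁ q) (k₁ m) + dist (k₁ m) (k₂ (-q)) = π := by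
      rw [h₁.dist_eq hq hm, hkm, h₂.dist_eq hm hq', angle_neg_right, angle_comm q m]
      ring
    rw [← X.cat1.between_of_between hqpm hpmq hpm hsum.le, hsum]

theorem exists_eventuallyEq_of_antipode {k : E (n + 1) → B} (hk : X.IsConeChart k)
    {p : E (n + 1)} (hp : p ≠ 0) {a : B} (ha : dist (k p) a = π) :
    ∃ k', X.IsConeChart k' ∧ k' (-p) = a ∧ k' =ᶠ[𝓝 p] k := by
  obtain ⟨e, hq_face, hq'_face, hreg⟩ := exists_regular_perturbation X.cellFunctional p
  obtain ⟨q, hq⟩ : ∃ q, q = p + e := ⟨_, rfl⟩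
  obtain ⟨q', hq'⟩ : ∃ q', q' = p - e := ⟨_, rfl⟩
  rw [← hq] at hq_face hreg
  rw [← hq'] at hq'_face
  have hp_mid : p = (1 / 2 : ℝ) • q + (1 / 2 : ℝ) • q' := by rw [hq, hq']; module
  have hq'_comb : q' = (2 : ℝ) • p + (1 : ℝ) • -q := by rw [hq, hq']; module
  have hq0 : q ≠ 0 := ne_zero_of_isFaceOf hq_face hp
  have hq'0 : q' ≠ 0 := ne_zero_of_isFaceOf hq'_face hp
  -- First a chart through `q'` and `a`, then one through `q` and the antipode of `q` in it.
  obtain ⟨k₂, h₂, hk₂q', y, hy, hk₂y⟩ := hk.exists_through hq'0 a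
  have hk₂p : k₂ p = k p := h₂.eq_of_isFaceOf hk hp hq'_face hk₂q'
  have hk₂a : k₂ (-p) = a := by
    rw [← hk₂y, h₂.map_neg_eq hp (ne_zero_of_norm_eq_one hy) (by rw [hk₂p, hk₂y, ha])]
  have hdist : dist (k q) (k₂ (-q)) = π :=
    hk.dist_map_map_neg h₂ hp hq0 hq'0 hk₂p.symm hk₂q'.symm one_half_pos one_half_pos hp_mid
  obtain ⟨k₃, h₃, hk₃q, hk₃_neg⟩ := hk.exists_through_antipode hq0 hdist
  have hk₃p : k₃ p = k p := h₃.eq_of_isFaceOf hk hp hq_face hk₃q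
  have hk₃q' : k₃ q' = k q' := by
    rw [← hk₂q']
    exact h₃.eq_of_eq_add_smul h₂ hp hq'0 (neg_ne_zero.2 hq0) (hk₃p.trans hk₂p.symm) hk₃_neg
      zero_le_two zero_le_one hq'_comb
  refine ⟨k₃, h₃, ?_, ?_⟩
  · rw [← hk₂a]
    exact h₃.eq_of_isFaceOf h₂ (neg_ne_zero.2 hp) hq_face.neg hk₃_neg
  · have hreflect : Tendsto (fun x : E (n + 1) => (2 : ℝ) • x - q') (𝓝 p) (𝓝 q) :=
      Continuous.tendsto' (by fun_prop) _ _ (by rw [hq, hq']; module)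
    have hnear_q := (h₃.eventuallyEq_of_regular hk hq0 hreg hk₃q).and (isOpen_ne.mem_nhds hq0)
    filter_upwards [hreflect.eventually hnear_q, isOpen_ne.mem_nhds hp] with x ⟨hx, hx0⟩ hx'
    exact h₃.eq_of_eq_add_smul hk hx0 hx' hq'0 hx hk₃q' one_half_pos.le one_half_pos.le (by module)

end SphericalBuilding.IsConeChart

/-! ### Convex spherical sets lie in apartments -/

theorem ne_smul_of_angle_mem_Ioo {V : Type*} [NormedAddCommGroup V] [InnerProductSpace ℝ V]
    {x y : V} (hx : x ≠ 0) (hy : y ≠ 0) (h : angle x y ∈ Set.Ioo 0 π) (r : ℝ) : y ≠ r • x := by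
  rintro rfl
  rcases (left_ne_zero_of_smul hy).lt_or_gt with hr | hr
  · exact h.2.ne (angle_eq_pi_iff.2 ⟨hx, r, hr, rfl⟩)
  · exact h.1.ne' (angle_eq_zero_iff.2 ⟨hx, r, hr, rfl⟩)

namespace IsSpherical

variable {M : Type*} [PseudoMetricSpace M] {C : Set M}

theorem dist_add_dist_of_dist_eq_pi (hC : IsSpherical C) {x y z : M} (hx : x ∈ C) (hy : y ∈ C)
    (hz : z ∈ C) (h : dist x y = π) : dist x z + dist z y = π := by
  obtain ⟨d, f, hf⟩ := hC
  have hf' (a b : C) : angle (f a : E (d + 1)) (f b) = dist (a : M) b := hf a b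
  rw [← hf' ⟨_, hx⟩ ⟨_, hy⟩] at h
  rw [← hf' ⟨_, hx⟩ ⟨_, hz⟩, ← hf' ⟨_, hz⟩ ⟨_, hy⟩, angle_comm (f ⟨z, hz⟩ : E (d + 1))]
  exact angle_add_angle_eq_pi_of_angle_eq_pi _ h

theorem dist_eq_angle_of_angle_add (hC : IsSpherical C) {V : Type*} [NormedAddCommGroup V]
    [InnerProductSpace ℝ V] {x m y z : V} (hx : x ≠ 0) (hm : m ≠ 0) (hy : y ≠ 0) (hz : z ≠ 0)
    (h : angle x y = angle x m + angle m y) (hpos : angle x m ∈ Set.Ioo 0 π) {x' m' y' z' : M}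
    (hx' : x' ∈ C) (hm' : m' ∈ C) (hy' : y' ∈ C) (hz' : z' ∈ C) (hxm : dist x' m' = angle x m)
    (hmy : dist m' y' = angle m y) (hxy : dist x' y' = angle x y) (hzx : dist z' x' = angle z x)
    (hzm : dist z' m' = angle z m) : dist z' y' = angle z y := by
  obtain ⟨d, f, hf⟩ := hC
  have hf' (a b : C) : angle (f a : E (d + 1)) (f b) = dist (a : M) b := hf a b
  rw [← hf' ⟨_, hx'⟩ ⟨_, hm'⟩] at hxm
  rw [← hf' ⟨_, hm'⟩ ⟨_, hy'⟩] at hmy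
  rw [← hf' ⟨_, hx'⟩ ⟨_, hy'⟩] at hxy
  rw [← hf' ⟨_, hz'⟩ ⟨_, hx'⟩] at hzx
  rw [← hf' ⟨_, hz'⟩ ⟨_, hm'⟩] at hzm
  rw [← hf' ⟨_, hz'⟩ ⟨_, hy'⟩]
  exact angle_eq_of_angle_add hx hm hy hz (f _).ne_zero (f _).ne_zero (f _).ne_zero (f _).ne_zero
    h hpos hxm hmy hxy hzx hzm

end IsSpherical

namespace SphericalBuilding

variable {n : ℕ} {B : Type*} [MetricSpace B] {X : SphericalBuilding n B}

namespace IsConeChart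

variable {k k' : E (n + 1) → B}

theorem eq_of_eventuallyEq_neg (hk : X.IsConeChart k) (hk' : X.IsConeChart k') {y z : E (n + 1)}
    (hy : y ≠ 0) (hz : z ≠ 0) (hgerm : k' =ᶠ[𝓝 (-y)] k)
    (hdist : dist (k z) (k' y) = angle z y) : k' z = k z := by
  have hy' : -y ≠ 0 := neg_ne_zero.2 hy
  rcases (angle_nonneg z y).eq_or_lt with h0 | h0
  · rw [← h0, dist_eq_zero] at hdist
    obtain ⟨-, r, hr, rfl⟩ := angle_eq_zero_iff.1 h0.symm
    rw [hdist, hk'.apply_smul hz hr]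
  rcases (angle_le_pi z y).eq_or_lt with hpi | hpi
  · obtain ⟨-, r, hr, rfl⟩ := angle_eq_pi_iff.1 hpi
    have hneg := hgerm.self_of_nhds
    rwa [← neg_smul, hk'.apply_smul hz (neg_pos.2 hr), hk.apply_smul hz (neg_pos.2 hr)] at hneg
  have htendsto : Tendsto (fun s : ℝ => -y + s • z) (𝓝[>] 0) (𝓝 (-y)) :=
    tendsto_nhdsWithin_of_tendsto_nhds (Continuous.tendsto' (by fun_prop) _ _ (by simp))
  obtain ⟨s, ⟨hkx, hx⟩, hs⟩ := ((htendsto.eventually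
    (hgerm.and (isOpen_ne.mem_nhds hy'))).and self_mem_nhdsWithin).exists
  set x := -y + s • z with hxd
  have hs0 : 0 ≤ s⁻¹ := (inv_pos.2 hs).le
  have hz_eq : z = s⁻¹ • x + s⁻¹ • y := by
    rw [← smul_add, hxd, neg_add_cancel_comm, inv_smul_smul₀ (ne_of_gt hs)]
  have hxy : dist (k x) (k' y) = angle x y := by rw [← hkx, hk'.dist_eq hx hy]
  have hlt : angle x y < π := by
    refine (angle_le_pi x y).lt_of_ne fun h => ?_
    obtain ⟨-, r, -, hyx⟩ := angle_eq_pi_iff.1 (angle_comm x y ▸ h)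
    refine ne_smul_of_angle_mem_Ioo hy hz (angle_comm z y ▸ ⟨h0, hpi⟩) (s⁻¹ * (r + 1)) ?_
    rw [mul_smul, add_smul, one_smul, ← hyx, smul_add]
    exact hz_eq
  refine X.cat1.eq_of_between (hxy.trans_lt hlt) ?_ ?_ ?_
  · rw [← hkx]
    exact hk'.between hx hz hy hs0 hs0 hz_eq
  · rw [Between, hxy, hdist, hk.dist_eq hx hz, angle_add_of_eq_add_smul hz hs0 hs0 hz_eq]
  · rw [hk.dist_eq hx hz, ← hkx, hk'.dist_eq hx hz]

theorem exists_extension_of_antipode (hk : X.IsConeChart k) {y : E (n + 1)} (hy : y ≠ 0) {a : B}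
    (ha : dist (k (-y)) a = π) :
    ∃ k', X.IsConeChart k' ∧ k' y = a ∧ ∀ z ≠ 0, dist (k z) a = angle z y → k' z = k z := by
  obtain ⟨k', hk', hk'a, hgerm⟩ := hk.exists_eventuallyEq_of_antipode (neg_ne_zero.2 hy) ha
  rw [neg_neg] at hk'a
  exact ⟨k', hk', hk'a, fun z hz hdist =>
    hk.eq_of_eventuallyEq_neg hk' hy hz hgerm (by rwa [hk'a])⟩

end IsConeChart

/-- The nonzero vectors that some chart sends into `C`. -/
def coneOver (X : SphericalBuilding n B) (C : Set B) : Set (E (n + 1)) :=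
  {x | x ≠ 0 ∧ ∃ k, X.IsConeChart k ∧ k x ∈ C}

variable {C : Set B} {u : E (n + 1)}

theorem exists_isFaceOf_of_isConvex (hconv : IsConvex C) (hu : u ≠ 0)
    (hmax : ∀ m ∈ X.coneOver C, IsFaceOf X.cellFunctional u m → IsFaceOf X.cellFunctional m u)
    {k : E (n + 1) → B} (hk : X.IsConeChart k) (hku : k u ∈ C) {v : E (n + 1)} (hv : v ≠ 0)
    (hkv : k v ∈ C) (huv : angle u v < π) :
    ∃ t ∈ Set.Ioo (0 : ℝ) 1, (1 - t) • u + t • v ≠ 0 ∧ k ((1 - t) • u + t • v) ∈ C ∧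
      IsFaceOf X.cellFunctional ((1 - t) • u + t • v) u := by
  have htendsto : Tendsto (fun t : ℝ => (1 - t) • u + t • v) (𝓝[>] 0) (𝓝 u) :=
    tendsto_nhdsWithin_of_tendsto_nhds (Continuous.tendsto' (by fun_prop) _ _ (by simp))
  obtain ⟨t, hface, ht⟩ := ((htendsto.eventually (eventually_isFaceOf X.cellFunctional u)).and
    (Ioo_mem_nhdsGT one_pos)).exists
  have hm := ne_zero_of_isFaceOf hface hu
  have hkm : k ((1 - t) • u + t • v) ∈ C :=
    hconv _ hku _ hkv (by rwa [hk.dist_eq hu hv]) _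
      (hk.between hu hm hv (sub_pos.2 ht.2).le ht.1.le rfl)
  exact ⟨t, ht, hm, hkm, hmax _ ⟨hm, k, hk, hkm⟩ hface⟩

theorem IsConeChart.exists_extension_of_eq_on_segment (hsph : IsSpherical C)
    {k k₂ : E (n + 1) → B} (hk : X.IsConeChart k) (h₂ : X.IsConeChart k₂) {v : E (n + 1)}
    (hu : u ≠ 0) (hv : v ≠ 0) (huv : angle u v ∈ Set.Ioo 0 π) {t : ℝ} (ht : t ∈ Set.Ioo 0 1)
    (hm : (1 - t) • u + t • v ≠ 0) (hku : k u = k₂ u)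
    (hkm : k ((1 - t) • u + t • v) = k₂ ((1 - t) • u + t • v)) (huC : k u ∈ C)
    (hmC : k ((1 - t) • u + t • v) ∈ C) (hvC : k₂ v ∈ C) :
    ∃ k', X.IsConeChart k' ∧ k' v = k₂ v ∧ ∀ z ≠ 0, k z ∈ C → k' z = k z := by
  set m := (1 - t) • u + t • v with hm_def
  have ht' : 0 < 1 - t := sub_pos.2 ht.2
  have hadd : angle u v = angle u m + angle m v :=
    angle_add_of_eq_add_smul hm ht'.le ht.1.le hm_def
  have hum : angle u m ∈ Set.Ioo 0 π := by
    refine ⟨(angle_nonneg u m).lt_of_ne' fun h => ?_, by linarith [huv.2, angle_nonneg m v]⟩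
    obtain ⟨-, r, -, hmr⟩ := angle_eq_zero_iff.1 h
    refine ne_smul_of_angle_mem_Ioo hu hv huv (t⁻¹ * (r - (1 - t))) ?_
    rw [mul_smul, sub_smul, ← hmr, hm_def, add_sub_cancel_left, inv_smul_smul₀ ht.1.ne']
  have hanti : dist (k (-v)) (k₂ (- -v)) = π := by
    refine hk.dist_map_map_neg h₂ hu (neg_ne_zero.2 hv) hm hku hkm (div_pos ht.1 ht')
      (inv_pos.2 ht') ?_
    rw [hm_def, smul_add, inv_smul_smul₀ ht'.ne', smul_smul, ← div_eq_inv_mul]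
    module
  rw [neg_neg] at hanti
  obtain ⟨k', hk', hk'v, hext⟩ := hk.exists_extension_of_antipode hv hanti
  refine ⟨k', hk', hk'v, fun z hz hzC => hext z hz ?_⟩
  exact hsph.dist_eq_angle_of_angle_add hu hm hv hz hadd hum huC hmC hvC hzC (hk.dist_eq hu hm)
    (by rw [hkm, h₂.dist_eq hm hv]) (by rw [hku, h₂.dist_eq hu hv]) (hk.dist_eq hz hu)
    (hk.dist_eq hz hm)

theorem IsConeChart.exists_extension (hconv : IsConvex C) (hsph : IsSpherical C) (hu : u ≠ 0)
    (hmax : ∀ m ∈ X.coneOver C, IsFaceOf X.cellFunctional u m → IsFaceOf X.cellFunctional m u)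
    {k : E (n + 1) → B} (hk : X.IsConeChart k) (huC : k u ∈ C) {c : B} (hc : c ∈ C) :
    ∃ k', X.IsConeChart k' ∧ (∃ v ≠ 0, k' v = c) ∧ ∀ z ≠ 0, k z ∈ C → k' z = k z := by
  obtain ⟨k₂, h₂, hk₂u, v, hv_norm, rfl⟩ := hk.exists_through hu c
  have hv := ne_zero_of_norm_eq_one hv_norm
  have huv : dist (k u) (k₂ v) = angle u v := by rw [← hk₂u, h₂.dist_eq hu hv]
  rcases (angle_nonneg u v).eq_or_lt with h0 | h0
  · exact ⟨k, hk, ⟨u, hu, dist_eq_zero.1 (huv.trans h0.symm)⟩, fun _ _ _ => rfl⟩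
  rcases (angle_le_pi u v).eq_or_lt with hpi | hpi
  · have hu' := neg_ne_zero.2 hu
    obtain ⟨k', hk', hk'u, hext⟩ :=
      hk.exists_extension_of_antipode hu' (by rw [neg_neg]; exact huv.trans hpi)
    refine ⟨k', hk', ⟨-u, hu', hk'u⟩, fun z hz hzC => hext z hz ?_⟩
    rw [angle_neg_right, angle_comm, ← hk.dist_eq hu hz,
      ← hsph.dist_add_dist_of_dist_eq_pi huC hc hzC (huv.trans hpi), add_sub_cancel_left]
  · obtain ⟨t, ht, hm, hmC, hface⟩ :=
      exists_isFaceOf_of_isConvex hconv hu hmax h₂ (hk₂u ▸ huC) hv hc hpi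
    have hkm := hk.eq_of_isFaceOf h₂ hm hface hk₂u.symm
    obtain ⟨k', hk', hk'v, hext⟩ := hk.exists_extension_of_eq_on_segment hsph h₂ hu hv ⟨h0, hpi⟩
      ht hm hk₂u.symm hkm huC (hkm ▸ hmC) hc
    exact ⟨k', hk', ⟨v, hv, hk'v⟩, hext⟩

theorem exists_isConeChart_superset (X : SphericalBuilding n B) (hconv : IsConvex C)
    (hsph : IsSpherical C) (hne : C.Nonempty) :
    ∃ k, X.IsConeChart k ∧ ∀ c ∈ C, ∃ x, ‖x‖ = 1 ∧ k x = c := by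
  have hcone : (X.coneOver C).Nonempty := by
    obtain ⟨c, hc⟩ := hne
    obtain ⟨k, hk, x, -, hx, -, rfl, -⟩ := X.exists_isConeChart_pair c c
    exact ⟨x, ne_zero_of_norm_eq_one hx, k, hk, hc⟩
  obtain ⟨u, ⟨hu, k₀, hk₀, hk₀u⟩, hu_max⟩ := exists_isFaceOf_symm X.cellFunctional hcone
  let signs (x : E (n + 1)) (j : Option X.W × Fin (n + 1)) : SignType :=
    SignType.sign (X.cellFunctional j x)
  obtain ⟨k, ⟨hk, hku⟩, hmax⟩ := exists_maximalFor_of_wellFoundedGT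
    (fun k => X.IsConeChart k ∧ k u ∈ C) (fun k => signs '' {x | x ≠ 0 ∧ k x ∈ C})
    ⟨k₀, hk₀, hk₀u⟩
  refine ⟨k, hk, fun c hc => ?_⟩
  obtain ⟨k', hk', ⟨v, hv, rfl⟩, hext⟩ := hk.exists_extension hconv hsph hu hu_max hku hc
  have hsub : signs '' {x | x ≠ 0 ∧ k x ∈ C} ⊆ signs '' {x | x ≠ 0 ∧ k' x ∈ C} :=
    Set.image_mono fun x ⟨hx, hxC⟩ => ⟨hx, by rwa [hext x hx hxC]⟩
  obtain ⟨z, ⟨hz, hzC⟩, hsign⟩ := hmax ⟨hk', by rwa [hext u hu hku]⟩ hsub ⟨v, ⟨hv, hc⟩, rfl⟩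
  refine ⟨normalize v, norm_normalize_eq_one_iff.2 hv, (hk.apply_normalize hv).trans ?_⟩
  exact hk.eq_of_isFaceOf hk' hv (isFaceOf_of_sign_eq fun j => (congrFun hsign j).symm)
    (hext z hz hzC).symm

end SphericalBuilding

/-! ### Isometrically embedded spheres are apartments -/

section SphereEmbedding

variable {M : Type*} {n : ℕ}

theorem IsSphereEmbedding.isSpherical [PseudoMetricSpace M] {F : USphere (n + 1) → M}
    (hF : IsSphereEmbedding F) : IsSpherical (Set.range F) :=
  ⟨n, fun a => a.2.choose, fun a b => by
    rw [← hF, a.2.choose_spec, b.2.choose_spec, Subtype.dist_eq]⟩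

theorem IsSphereEmbedding.isConvex [MetricSpace M] (hM : IsCAT1 M) {F : USphere n → M}
    (hF : IsSphereEmbedding F) : IsConvex (Set.range F) := by
  rintro _ ⟨v, rfl⟩ _ ⟨w, rfl⟩ hlt m hm
  have hvw : dist (F v) (F w) = angle (v : E n) w := hF v w
  have hle : dist (F v) m ≤ dist (F v) (F w) :=
    (le_add_of_nonneg_right dist_nonneg).trans_eq hm
  rcases (dist_nonneg (x := F v) (y := F w)).eq_or_lt with h0 | h0
  · exact ⟨v, dist_le_zero.1 (hle.trans h0.ge)⟩
  obtain ⟨e, he, hw⟩ := exists_eq_greatCircle (norm_eq_of_mem_sphere v) (norm_eq_of_mem_sphere w)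
    (hvw ▸ ⟨h0, hlt⟩)
  rw [← hvw] at hw
  have hs : dist (F v) m ∈ Set.Icc 0 π := ⟨dist_nonneg, hle.trans hlt.le⟩
  let p : USphere n := ⟨greatCircle v e (dist (F v) m), mem_sphere_zero_iff_norm.2
    (norm_greatCircle he _)⟩
  have hvp : dist (F v) (F p) = dist (F v) m := (hF v p).trans (angle_greatCircle_left he hs)
  have hpw : dist (F p) (F w) = dist (F v) (F w) - dist (F v) m := by
    have habs : |dist (F v) m - dist (F v) (F w)| = dist (F v) (F w) - dist (F v) m := by
      rw [abs_sub_comm, abs_of_nonneg (sub_nonneg.2 hle)]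
    rw [hF p w, angDist, hw, angle_greatCircle he, habs]
    rw [habs]
    exact (sub_le_self _ dist_nonneg).trans hlt.le
  exact ⟨p, hM.eq_of_between hlt (by rw [Between, hvp, hpw]; ring) hm hvp⟩

theorem surjective_of_angDist_eq {f : USphere n → USphere n}
    (hf : ∀ u v, angDist (f u) (f v) = angDist u v) : Function.Surjective f := by
  have hinner (u v : USphere n) : ⟪(f u : E n), f v⟫ = ⟪(u : E n), (v : E n)⟫ := by
    rw [inner_eq_cos_angle_of_norm_eq_one (norm_eq_of_mem_sphere _) (norm_eq_of_mem_sphere _),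
      inner_eq_cos_angle_of_norm_eq_one (norm_eq_of_mem_sphere _) (norm_eq_of_mem_sphere _)]
    exact congrArg Real.cos (hf u v)
  obtain ⟨s, hs⟩ : ∃ s : Fin n → USphere n, ∀ i, (s i : E n) = EuclideanSpace.single i 1 :=
    ⟨fun i => ⟨EuclideanSpace.single i 1, by simp⟩, fun _ => rfl⟩
  have hcoord (i : Fin n) (v : USphere n) : ⟪(f (s i) : E n), f v⟫ = (v : E n) i := by
    rw [hinner, hs, EuclideanSpace.inner_single_left, map_one, one_mul]
  have hortho : Orthonormal ℝ (Set.univ.domRestrict fun i => (f (s i) : E n)) :=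
    ⟨fun i => norm_eq_of_mem_sphere _, fun i j hij => (hcoord i (s j)).trans (by
      rw [hs, PiLp.single_apply, if_neg (Subtype.coe_injective.ne hij)])⟩
  obtain ⟨b, hb⟩ := hortho.exists_orthonormalBasis_extension_of_card_eq (by simp)
  intro w
  have hw : ‖b.repr w‖ = 1 := by rw [LinearIsometryEquiv.norm_map, norm_eq_of_mem_sphere]
  refine ⟨⟨b.repr w, mem_sphere_zero_iff_norm.2 hw⟩, Subtype.ext (b.repr.injective ?_)⟩
  ext i
  rw [b.repr_apply_apply, hb i trivial, hcoord]

theorem SphericalBuilding.isApartment_range [MetricSpace M] (X : SphericalBuilding n M)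
    {F : USphere (n + 1) → M} (hF : IsSphereEmbedding F) : X.IsApartment (Set.range F) := by
  obtain ⟨k, ⟨ι, hι, hk⟩, hsup⟩ := X.exists_isConeChart_superset (hF.isConvex X.cat1)
    hF.isSpherical ⟨F ⟨EuclideanSpace.single 0 1, by simp⟩, Set.mem_range_self _⟩
  have hpre (v : USphere (n + 1)) : ∃ w, ι w = F v := by
    obtain ⟨y, hy, hky⟩ := hsup (F v) ⟨v, rfl⟩
    exact ⟨⟨y, mem_sphere_zero_iff_norm.2 hy⟩, by rw [← hk _ 1 one_pos, one_smul, hky]⟩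
  choose f hf using hpre
  have hsurj : Function.Surjective f :=
    surjective_of_angDist_eq fun v w => by rw [← X.isometric ι hι, hf, hf, hF]
  refine ⟨ι, hι, ?_⟩
  rw [← hsurj.range_comp, Function.comp_def]
  simp only [hf]

end SphereEmbedding

/-! ### Geodesics and directions -/

section Comparison

variable {α : Type*} {l : Filter α} {s t d : α → ℝ} {a : ℝ}

theorem mul_sinc (y : ℝ) : y * Real.sinc y = Real.sin y := by
  rcases eq_or_ne y 0 with rfl | h
  · simp
  · rw [Real.sinc_of_ne_zero h, mul_div_cancel₀ _ h]

theorem sq_sub_sq_mul_sinc_of_cos_eq {s t d a : ℝ}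
    (h : Real.cos d = Real.cos s * Real.cos t + Real.sin s * Real.sin t * a) :
    (d ^ 2 - (s - t) ^ 2) * (Real.sinc ((d + (s - t)) / 2) * Real.sinc ((d - (s - t)) / 2))
      = 2 * s * t * (Real.sinc s * Real.sinc t) * (1 - a) := by
  have hprod := Real.cos_sub_cos d (s - t)
  rw [h, Real.cos_sub, ← mul_sinc ((d + (s - t)) / 2), ← mul_sinc ((d - (s - t)) / 2),
    ← mul_sinc s, ← mul_sinc t] at hprod
  linear_combination 2 * hprod

/-- Infinitesimally, the spherical law of cosines is the Euclidean one. -/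
theorem tendsto_comparison_cos (hs : Tendsto s l (𝓝 0)) (ht : Tendsto t l (𝓝 0))
    (hd : Tendsto d l (𝓝 0)) (hs0 : ∀ᶠ i in l, 0 < s i) (ht0 : ∀ᶠ i in l, 0 < t i)
    (hcos : ∀ᶠ i in l, Real.cos (d i)
      = Real.cos (s i) * Real.cos (t i) + Real.sin (s i) * Real.sin (t i) * a) :
    Tendsto (fun i => (s i ^ 2 + t i ^ 2 - d i ^ 2) / (2 * s i * t i)) l (𝓝 a) := by
  have hsinc {f : α → ℝ} (hf : Tendsto f l (𝓝 0)) : Tendsto (fun i => Real.sinc (f i)) l (𝓝 1) :=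
    (Real.continuous_sinc.tendsto' 0 1 Real.sinc_zero).comp hf
  have hplus : Tendsto (fun i => (d i + (s i - t i)) / 2) l (𝓝 0) := by
    simpa using (hd.add (hs.sub ht)).div_const 2
  have hminus : Tendsto (fun i => (d i - (s i - t i)) / 2) l (𝓝 0) := by
    simpa using (hd.sub (hs.sub ht)).div_const 2
  have hden := (hsinc hplus).mul (hsinc hminus)
  have hlim := ((((hsinc hs).mul (hsinc ht)).div hden (by norm_num)).const_mul (1 - a)).const_sub 1
  rw [mul_one, div_one, mul_one, sub_sub_cancel] at hlim
  refine hlim.congr' ?_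
  filter_upwards [hs0, ht0, hcos, hden.eventually_ne (by norm_num : (1 : ℝ) * 1 ≠ 0)]
    with i hs ht hc hn
  have key := sq_sub_sq_mul_sinc_of_cos_eq hc
  obtain ⟨hplus, hminus⟩ := mul_ne_zero_iff.1 hn
  simp only [Pi.div_apply]
  field_simp
  linear_combination key

end Comparison

section Geodesics

theorem eventually_of_forall_mem_Icc {P : ℝ → Prop} {ε : ℝ} (hε : 0 < ε)
    (h : ∀ t ∈ Set.Icc 0 ε, P t) : ∀ᶠ t in 𝓝[>] 0, P t := by
  filter_upwards [Ioc_mem_nhdsGT hε] with t ht using h t (Set.Ioc_subset_Icc_self ht)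

section PseudoMetric

variable {M : Type*} [PseudoMetricSpace M] {x : M}

theorem gAngle_congr {c₁ c₁' c₂ c₂' : GeodesicFrom x} (h₁ : c₁.toFun =ᶠ[𝓝[>] 0] c₁'.toFun)
    (h₂ : c₂.toFun =ᶠ[𝓝[>] 0] c₂'.toFun) : gAngle c₁ c₂ = gAngle c₁' c₂' := by
  refine limsup_congr ?_
  filter_upwards [h₁.prod_mk h₂] with p hp
  rw [hp.1, hp.2]

theorem mk_eq_mk_of_eventuallyEq {c c' : GeodesicFrom x} (h : c.toFun =ᶠ[𝓝[>] 0] c'.toFun) :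
    (SeparationQuotient.mk c : Directions x) = SeparationQuotient.mk c' :=
  SeparationQuotient.mk_eq_mk.2 <| Metric.inseparable_iff.2 <|
    (gAngle_congr EventuallyEq.rfl h.symm).trans (gAngle_self c)

theorem gAngle_eq_of_cos_dist {c c' : GeodesicFrom x} {θ : ℝ} (hθ : θ ∈ Set.Icc 0 π)
    (h : ∀ᶠ p : ℝ × ℝ in 𝓝[>] 0 ×ˢ 𝓝[>] 0, Real.cos (dist (c.toFun p.1) (c'.toFun p.2))
      = Real.cos p.1 * Real.cos p.2 + Real.sin p.1 * Real.sin p.2 * Real.cos θ) :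
    gAngle c c' = θ := by
  have hdist (c : GeodesicFrom x) : ∀ᶠ t in 𝓝[>] (0 : ℝ), dist x (c.toFun t) = t :=
    eventually_of_forall_mem_Icc c.length_pos fun t ht => dist_start c ht.1 ht.2
  have hfst : Tendsto (Prod.fst : ℝ × ℝ → ℝ) (𝓝[>] 0 ×ˢ 𝓝[>] 0) (𝓝 0) :=
    tendsto_fst.mono_right nhdsWithin_le_nhds
  have hsnd : Tendsto (Prod.snd : ℝ × ℝ → ℝ) (𝓝[>] 0 ×ˢ 𝓝[>] 0) (𝓝 0) :=
    tendsto_snd.mono_right nhdsWithin_le_nhds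
  have hlim : Tendsto (fun p : ℝ × ℝ => dist (c.toFun p.1) (c'.toFun p.2))
      (𝓝[>] 0 ×ˢ 𝓝[>] 0) (𝓝 0) := by
    refine squeeze_zero' (Eventually.of_forall fun _ => dist_nonneg) ?_
      (by simpa using hfst.add hsnd)
    filter_upwards [(hdist c).prod_mk (hdist c')] with p hp
    exact (dist_triangle_left _ _ x).trans_eq (congrArg₂ _ hp.1 hp.2)
  have hcomp := tendsto_comparison_cos hfst hsnd hlim
    (tendsto_fst.eventually self_mem_nhdsWithin) (tendsto_snd.eventually self_mem_nhdsWithin) h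
  have harccos := (Real.continuous_arccos.tendsto' _ θ (Real.arccos_cos hθ.1 hθ.2)).comp hcomp
  refine (harccos.congr' ?_).limsup_eq
  filter_upwards [(hdist c).prod_mk (hdist c')] with p hp
  rw [Function.comp, compAngle, hp.1, hp.2]

theorem GeodesicFrom.between (c : GeodesicFrom x) {r s t : ℝ} (hr : 0 ≤ r)
    (hs : s ∈ Set.Icc r t) (ht : t ≤ c.length) :
    Between (c.toFun r) (c.toFun s) (c.toFun t) := by
  have hr' : r ∈ Set.Icc 0 c.length := ⟨hr, (hs.1.trans hs.2).trans ht⟩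
  have hs' : s ∈ Set.Icc 0 c.length := ⟨hr.trans hs.1, hs.2.trans ht⟩
  have ht' : t ∈ Set.Icc 0 c.length := ⟨hs'.1.trans hs.2, ht⟩
  rw [Between, c.isometric r hr' s hs', c.isometric s hs' t ht', c.isometric r hr' t ht',
    abs_of_nonpos (sub_nonpos.2 hs.1), abs_of_nonpos (sub_nonpos.2 hs.2),
    abs_of_nonpos (sub_nonpos.2 (hs.1.trans hs.2))]
  ring

theorem GeodesicFrom.between_start (c : GeodesicFrom x) {s t : ℝ} (hs : s ∈ Set.Icc 0 t)
    (ht : t ≤ c.length) : Between x (c.toFun s) (c.toFun t) := by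
  simpa only [c.map_zero] using c.between le_rfl hs ht

theorem IsConvex.mk_mem_directionsOf {C : Set M} (hC : IsConvex C) (hx : x ∈ C)
    {c : GeodesicFrom x} {t : ℝ} (ht : 0 < t) (htc : t ≤ c.length) (htπ : t < π)
    (hct : c.toFun t ∈ C) : SeparationQuotient.mk c ∈ directionsOf C x := by
  let c' : GeodesicFrom x :=
    { c with
      length := t
      length_pos := ht
      isometric := fun r hr s hs =>
        c.isometric r ⟨hr.1, hr.2.trans htc⟩ s ⟨hs.1, hs.2.trans htc⟩ }
  exact ⟨c', fun s hs => hC x hx _ hct (by rwa [dist_start c ht.le htc]) _ (c.between_start hs htc),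
    mk_eq_mk_of_eventuallyEq EventuallyEq.rfl⟩

/-- `c` is a geodesic of length `π` that ends at `z`. -/
structure GeodesicFrom.IsRayTo (c : GeodesicFrom x) (z : M) : Prop where
  length_eq : c.length = π
  apply_pi : c.toFun π = z

theorem GeodesicFrom.IsRayTo.dist_eq {c : GeodesicFrom x} {z : M} (hc : c.IsRayTo z) {s t : ℝ}
    (hs : s ∈ Set.Icc 0 π) (ht : t ∈ Set.Icc 0 π) : dist (c.toFun s) (c.toFun t) = |s - t| :=
  c.isometric s (hc.length_eq ▸ hs) t (hc.length_eq ▸ ht)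

theorem GeodesicFrom.IsRayTo.dist_eq_pi {c : GeodesicFrom x} {z : M} (hc : c.IsRayTo z) :
    dist x z = π := by
  rw [← hc.apply_pi, dist_start c Real.pi_pos.le hc.length_eq.ge]

end PseudoMetric

variable {M : Type*} [MetricSpace M] {x : M}

theorem IsCAT1.eqOn_of_apply_eq (hM : IsCAT1 M) {c c' : GeodesicFrom x} {t : ℝ}
    (htc : t ≤ c.length) (htc' : t ≤ c'.length) (htπ : t < π) (h : c.toFun t = c'.toFun t) :
    Set.EqOn c.toFun c'.toFun (Set.Icc 0 t) := by
  intro s hs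
  refine hM.eq_of_between ?_ (c.between_start hs htc) (h ▸ c'.between_start hs htc') ?_
  · rwa [dist_start c (hs.1.trans hs.2) htc]
  · rw [dist_start c hs.1 (hs.2.trans htc), dist_start c' hs.1 (hs.2.trans htc')]

theorem IsCAT1.mk_eq_mk_of_apply_eq (hM : IsCAT1 M) {c c' : GeodesicFrom x} {t : ℝ} (ht : 0 < t)
    (htc : t ≤ c.length) (htc' : t ≤ c'.length) (htπ : t < π) (h : c.toFun t = c'.toFun t) :
    (SeparationQuotient.mk c : Directions x) = SeparationQuotient.mk c' :=
  mk_eq_mk_of_eventuallyEq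
    (eventually_of_forall_mem_Icc ht (hM.eqOn_of_apply_eq htc htc' htπ h))

theorem GeodesicFrom.IsRayTo.eqOn (hM : IsCAT1 M) {c c' : GeodesicFrom x} {z : M}
    (hc : c.IsRayTo z) (hc' : c'.IsRayTo z) (h : c.toFun =ᶠ[𝓝[>] 0] c'.toFun) :
    Set.EqOn c.toFun c'.toFun (Set.Icc 0 π) := by
  intro t ht
  rcases ht.1.eq_or_lt with rfl | h0
  · rw [c.map_zero, c'.map_zero]
  obtain ⟨s, hs, hs0, hst⟩ := (h.and (Ioo_mem_nhdsGT h0)).exists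
  have hsπ : s ∈ Set.Icc 0 π := ⟨hs0.le, hst.le.trans ht.2⟩
  have hbetween {c : GeodesicFrom x} (hc : c.IsRayTo z) : Between (c.toFun s) (c.toFun t) z :=
    hc.apply_pi ▸ c.between hs0.le ⟨hst.le, ht.2⟩ hc.length_eq.ge
  refine hM.eq_of_between ?_ (hbetween hc) (hs ▸ hbetween hc') ?_
  · rw [← hc.apply_pi, hc.dist_eq hsπ (Set.right_mem_Icc.2 Real.pi_pos.le),
      abs_of_nonpos (sub_nonpos.2 hsπ.2)]
    linarith
  · rw [hc.dist_eq hsπ ht, hs, hc'.dist_eq hsπ ht]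

end Geodesics

namespace SphericalBuilding

variable {n : ℕ} {B : Type*} [MetricSpace B] {X : SphericalBuilding n B}

namespace IsConeChart

variable {k : E (n + 1) → B} {u e e' : E (n + 1)} {x : B}

theorem dist_greatCircle (hk : X.IsConeChart k) (h : IsUnitTangent u e) {s t : ℝ}
    (hst : |s - t| ≤ π) : dist (k (greatCircle u e s)) (k (greatCircle u e t)) = |s - t| := by
  rw [hk.dist_eq (ne_zero_of_norm_eq_one (norm_greatCircle h s))
    (ne_zero_of_norm_eq_one (norm_greatCircle h t)), angle_greatCircle h hst]

theorem cos_dist_greatCircle (hk : X.IsConeChart k) (h : IsUnitTangent u e)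
    (h' : IsUnitTangent u e') (s t : ℝ) :
    Real.cos (dist (k (greatCircle u e s)) (k (greatCircle u e' t)))
      = Real.cos s * Real.cos t + Real.sin s * Real.sin t * Real.cos (angle e e') := by
  have hs := norm_greatCircle h s
  have ht := norm_greatCircle h' t
  rw [hk.dist_eq (ne_zero_of_norm_eq_one hs) (ne_zero_of_norm_eq_one ht),
    ← inner_eq_cos_angle_of_norm_eq_one hs ht, inner_greatCircle h h',
    inner_eq_cos_angle_of_norm_eq_one h.norm_right h'.norm_right]

/-- The image under a chart of a half great circle, as a geodesic. -/
@[simps] def geodesic (hk : X.IsConeChart k) (hx : k u = x) (h : IsUnitTangent u e) :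
    GeodesicFrom x where
  length := π
  length_pos := Real.pi_pos
  toFun t := k (greatCircle u e t)
  map_zero := by rw [greatCircle_zero, hx]
  isometric s hs t ht := hk.dist_greatCircle h
    (abs_le.2 ⟨by linarith [hs.1, ht.2], by linarith [hs.2, ht.1]⟩)

theorem gAngle_geodesic (hk : X.IsConeChart k) (hx : k u = x) (h : IsUnitTangent u e)
    (h' : IsUnitTangent u e') : gAngle (hk.geodesic hx h) (hk.geodesic hx h') = angle e e' :=
  gAngle_eq_of_cos_dist ⟨angle_nonneg _ _, angle_le_pi _ _⟩
    (Eventually.of_forall fun p => hk.cos_dist_greatCircle h h' p.1 p.2)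

theorem exists_eqOn_geodesic (hk : X.IsConeChart k) (hu : ‖u‖ = 1) (hx : k u = x)
    (c : GeodesicFrom x) {t : ℝ} (ht : t ∈ Set.Ioo 0 π) (htc : t ≤ c.length) {y : E (n + 1)}
    (hy : ‖y‖ = 1) (hky : k y = c.toFun t) :
    ∃ e, ∃ h : IsUnitTangent u e, Set.EqOn c.toFun (hk.geodesic hx h).toFun (Set.Icc 0 t) := by
  have hangle : angle u y = t := by
    rw [← hk.dist_eq (ne_zero_of_norm_eq_one hu) (ne_zero_of_norm_eq_one hy), hx, hky,
      dist_start c ht.1.le htc]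
  obtain ⟨e, he, hye⟩ := exists_eq_greatCircle hu hy (hangle ▸ ht)
  rw [hangle] at hye
  refine ⟨e, he, X.cat1.eqOn_of_apply_eq htc ht.2.le ht.2 ?_⟩
  rw [geodesic_toFun, ← hye, hky]

end IsConeChart

theorem tendsto_greatCircle_nhdsGT (u e : E (n + 1)) : Tendsto (greatCircle u e) (𝓝[>] 0) (𝓝 u) :=
  tendsto_nhdsWithin_of_tendsto_nhds
    ((continuous_greatCircle u e).tendsto' 0 u (greatCircle_zero u e))

theorem exists_common_chart_geodesics (X : SphericalBuilding n B) {x : B}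
    (c₁ c₂ : GeodesicFrom x) :
    ∃ (k : E (n + 1) → B) (u e₁ e₂ : E (n + 1)) (hk : X.IsConeChart k) (hx : k u = x)
      (h₁ : IsUnitTangent u e₁) (h₂ : IsUnitTangent u e₂),
      c₁.toFun =ᶠ[𝓝[>] 0] (hk.geodesic hx h₁).toFun ∧
      c₂.toFun =ᶠ[𝓝[>] 0] (hk.geodesic hx h₂).toFun := by
  have hmin (c : GeodesicFrom x) : min c.length 1 ∈ Set.Ioo 0 π :=
    ⟨lt_min c.length_pos one_pos, (min_le_right _ _).trans_lt (by linarith [Real.pi_gt_three])⟩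
  obtain ⟨k₁, h₁, u, y₁, hu, hy₁, hku, hky₁⟩ :=
    X.exists_isConeChart_pair x (c₁.toFun (min c₁.length 1))
  obtain ⟨e, he, hce⟩ := h₁.exists_eqOn_geodesic hu hku c₁ (hmin c₁) (min_le_left _ _) hy₁ hky₁
  -- A chart through a point of the first geodesic whose cell has `u` in its closure contains `u`.
  obtain ⟨t, hface, ht0, ht⟩ := (((tendsto_greatCircle_nhdsGT u e).eventually
    (eventually_isFaceOf X.cellFunctional u)).and (Ioo_mem_nhdsGT (hmin c₁).1)).exists
  have hq := norm_greatCircle he t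
  obtain ⟨k, hk, hkq, y₂, hy₂, hky₂⟩ := h₁.exists_through (ne_zero_of_norm_eq_one hq)
    (c₂.toFun (min c₂.length 1))
  have hkx : k u = x := (hk.eq_of_isFaceOf h₁ (ne_zero_of_norm_eq_one hu) hface hkq).trans hku
  obtain ⟨e₁, he₁, hce₁⟩ := hk.exists_eqOn_geodesic hu hkx c₁ ⟨ht0, ht.trans (hmin c₁).2⟩
    (ht.le.trans (min_le_left _ _)) hq (hkq.trans (hce ⟨ht0.le, ht.le⟩).symm)
  obtain ⟨e₂, he₂, hce₂⟩ := hk.exists_eqOn_geodesic hu hkx c₂ (hmin c₂) (min_le_left _ _) hy₂ hky₂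
  exact ⟨k, u, e₁, e₂, hk, hkx, he₁, he₂, eventually_of_forall_mem_Icc ht0 hce₁,
    eventually_of_forall_mem_Icc (hmin c₂).1 hce₂⟩

theorem IsConeChart.isRayTo_geodesic {k : E (n + 1) → B} (hk : X.IsConeChart k) {u e : E (n + 1)}
    {x : B} (hx : k u = x) (h : IsUnitTangent u e) : (hk.geodesic hx h).IsRayTo (k (-u)) :=
  ⟨rfl, by rw [geodesic_toFun, greatCircle_pi]⟩

end SphericalBuilding

/-! ### Suspensions of round spheres of directions -/

theorem IsRoundSphere.exists_tangent_parametrization {n : ℕ} {M : Type*} [PseudoMetricSpace M]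
    {A : Set M} (hA : IsRoundSphere n A) {u : E (n + 1)} (hu : ‖u‖ = 1) :
    ∃ ψ : {e // IsUnitTangent u e} → M,
      (∀ e e', dist (ψ e) (ψ e') = angle (e : E (n + 1)) e') ∧ Set.range ψ = A := by
  obtain ⟨f, hf, rfl⟩ := hA
  have : Fact (Module.finrank ℝ (E (n + 1)) = n + 1) := ⟨by simp⟩
  let L := (OrthonormalBasis.fromOrthogonalSpanSingleton (𝕜 := ℝ) n
    (ne_zero_of_norm_eq_one hu)).repr
  let J : E n →ₗᵢ[ℝ] E (n + 1) := (Submodule.subtypeₗᵢ _).comp L.symm.toLinearIsometry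
  have hJ (η : E n) : ⟪u, J η⟫ = 0 :=
    Submodule.mem_orthogonal_singleton_iff_inner_right.1 (L.symm η).2
  have hJL (e : E (n + 1)) (he : ⟪u, e⟫ = 0) : ∃ η, J η = e :=
    ⟨L ⟨e, Submodule.mem_orthogonal_singleton_iff_inner_right.2 he⟩, by simp [J]⟩
  choose K hK using fun e : {e // IsUnitTangent u e} => hJL e e.2.inner_eq_zero
  have hKnorm (e : {e // IsUnitTangent u e}) : K e ∈ sphere (0 : E n) 1 := by
    rw [mem_sphere_zero_iff_norm, ← J.norm_map, hK, e.2.norm_right]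
  refine ⟨fun e => f ⟨K e, hKnorm e⟩, fun e e' => ?_, ?_⟩
  · rw [hf, angDist, ← J.angle_map, hK, hK]
  · refine (Set.range_subset_iff.2 fun e => Set.mem_range_self _).antisymm ?_
    rintro _ ⟨η, rfl⟩
    have hη : IsUnitTangent u (J η) := ⟨hu, by rw [J.norm_map, norm_eq_of_mem_sphere], hJ η⟩
    exact ⟨⟨J η, hη⟩, congrArg f (Subtype.ext (J.injective (hK ⟨J η, hη⟩)))⟩

namespace SphericalBuilding

variable {n : ℕ} {B : Type*} [MetricSpace B] {x z : B}

theorem exists_common_chart_geodesics_of_antipode (X : SphericalBuilding n B)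
    (hxz : dist x z = π) (c₁ c₂ : GeodesicFrom x) :
    ∃ (k : E (n + 1) → B) (u e₁ e₂ : E (n + 1)) (hk : X.IsConeChart k) (hx : k u = x)
      (h₁ : IsUnitTangent u e₁) (h₂ : IsUnitTangent u e₂), k (-u) = z ∧
      c₁.toFun =ᶠ[𝓝[>] 0] (hk.geodesic hx h₁).toFun ∧
      c₂.toFun =ᶠ[𝓝[>] 0] (hk.geodesic hx h₂).toFun := by
  obtain ⟨k, u, e₁, e₂, hk, rfl, h₁, h₂, hc₁, hc₂⟩ := X.exists_common_chart_geodesics c₁ c₂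
  obtain ⟨k', hk', hz, heq⟩ :=
    hk.exists_eventuallyEq_of_antipode (ne_zero_of_norm_eq_one h₁.norm_left) hxz
  have hgerm (e : E (n + 1)) : k ∘ greatCircle u e =ᶠ[𝓝[>] 0] k' ∘ greatCircle u e :=
    heq.symm.comp_tendsto (tendsto_greatCircle_nhdsGT u e)
  exact ⟨k', u, e₁, e₂, hk', heq.self_of_nhds, h₁, h₂, hz, hc₁.trans (hgerm e₁),
    hc₂.trans (hgerm e₂)⟩

theorem exists_isRayTo (X : SphericalBuilding n B) (hxz : dist x z = π) (ξ : Directions x) :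
    ∃ c : GeodesicFrom x, c.IsRayTo z ∧ SeparationQuotient.mk c = ξ := by
  obtain ⟨c, rfl⟩ := SeparationQuotient.surjective_mk ξ
  obtain ⟨k, u, e, -, hk, hx, he, -, rfl, hc, -⟩ :=
    X.exists_common_chart_geodesics_of_antipode hxz c c
  exact ⟨hk.geodesic hx he, hk.isRayTo_geodesic hx he, mk_eq_mk_of_eventuallyEq hc.symm⟩

theorem cos_dist_of_isRayTo (X : SphericalBuilding n B) {c c' : GeodesicFrom x}
    (hc : c.IsRayTo z) (hc' : c'.IsRayTo z) {s t : ℝ} (hs : s ∈ Set.Icc 0 π)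
    (ht : t ∈ Set.Icc 0 π) :
    Real.cos (dist (c.toFun s) (c'.toFun t)) = Real.cos s * Real.cos t
      + Real.sin s * Real.sin t * Real.cos (gAngle c c') := by
  obtain ⟨k, u, e, e', hk, hx, he, he', rfl, heq, heq'⟩ :=
    X.exists_common_chart_geodesics_of_antipode hc.dist_eq_pi c c'
  rw [hc.eqOn X.cat1 (hk.isRayTo_geodesic hx he) heq hs,
    hc'.eqOn X.cat1 (hk.isRayTo_geodesic hx he') heq' ht, gAngle_congr heq heq',
    hk.gAngle_geodesic, IsConeChart.geodesic_toFun, IsConeChart.geodesic_toFun,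
    hk.cos_dist_greatCircle he he']

end SphericalBuilding

section Suspension

variable {M : Type*} [PseudoMetricSpace M] {x : M}

/-- The union of all geodesics of length `π` from `x` to `z` whose direction at `x` lies in `Ax`.
The poles are added by hand since `Ax` may be empty. -/
def suspension (z : M) (Ax : Set (Directions x)) : Set M :=
  {x, z} ∪ {y | ∃ c : GeodesicFrom x, c.IsRayTo z ∧ SeparationQuotient.mk c ∈ Ax ∧
    ∃ t ∈ Set.Ioo 0 π, c.toFun t = y}

/-- Given a parametrization `ψ` of a set of directions at `x` by the unit tangent vectors of the
sphere at `u`, the point `y` of the suspension of that set with poles `x` and `z` has the same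
polar coordinates as the point `v` of the sphere. -/
inductive IsSuspensionPoint {n : ℕ} {u : E (n + 1)} (z : M)
    (ψ : {e // IsUnitTangent u e} → Directions x) : E (n + 1) → M → Prop
  | start : IsSuspensionPoint z ψ u x
  | antipode : IsSuspensionPoint z ψ (-u) z
  | ray (e : {e // IsUnitTangent u e}) {c : GeodesicFrom x} (hc : c.IsRayTo z)
      (hce : SeparationQuotient.mk c = ψ e) {t : ℝ} (ht : t ∈ Set.Ioo 0 π) :
      IsSuspensionPoint z ψ (greatCircle u e t) (c.toFun t)

end Suspension

namespace IsSuspensionPoint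

variable {n : ℕ} {B : Type*} [MetricSpace B] {x z : B} {u v v' : E (n + 1)} {y y' : B}
  {ψ : {e // IsUnitTangent u e} → Directions x}

theorem mem_suspension (h : IsSuspensionPoint z ψ v y) : y ∈ suspension z (Set.range ψ) := by
  cases h with
  | start => exact .inl (.inl rfl)
  | antipode => exact .inl (.inr rfl)
  | ray e hc hce ht => exact .inr ⟨_, hc, ⟨e, hce.symm⟩, _, ht, rfl⟩

theorem exists_of_mem_suspension (hu : ‖u‖ = 1) (hy : y ∈ suspension z (Set.range ψ)) :
    ∃ v, ‖v‖ = 1 ∧ IsSuspensionPoint z ψ v y := by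
  rcases hy with (rfl | rfl) | ⟨c, hc, ⟨e, he⟩, t, ht, rfl⟩
  · exact ⟨u, hu, .start⟩
  · exact ⟨-u, (norm_neg u).trans hu, .antipode⟩
  · exact ⟨_, norm_greatCircle e.2 t, .ray e hc he.symm ht⟩

theorem exists_of_norm_eq_one (X : SphericalBuilding n B) (hxz : dist x z = π) (hu : ‖u‖ = 1)
    (hv : ‖v‖ = 1) : ∃ y, IsSuspensionPoint z ψ v y := by
  obtain rfl | rfl | ⟨e, he, t, ht, rfl⟩ := eq_or_eq_neg_or_exists_eq_greatCircle hu hv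
  · exact ⟨x, .start⟩
  · exact ⟨z, .antipode⟩
  · obtain ⟨c, hc, hce⟩ := X.exists_isRayTo hxz (ψ ⟨e, he⟩)
    exact ⟨c.toFun t, .ray ⟨e, he⟩ hc hce ht⟩

theorem dist_left (hxz : dist x z = π) (hu : ‖u‖ = 1) (h : IsSuspensionPoint z ψ v y) :
    dist x y = angle u v := by
  cases h with
  | start => rw [dist_self, angle_self (ne_zero_of_norm_eq_one hu)]
  | antipode => rw [hxz, angle_self_neg_of_nonzero (ne_zero_of_norm_eq_one hu)]
  | @ray e c hc hce t ht =>
    rw [dist_start c ht.1.le (ht.2.le.trans hc.length_eq.ge),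
      angle_greatCircle_left e.2 (Set.Ioo_subset_Icc_self ht)]

theorem dist_right (hxz : dist x z = π) (hu : ‖u‖ = 1) (h : IsSuspensionPoint z ψ v y) :
    dist z y = angle (-u) v := by
  rw [angle_neg_left, ← h.dist_left hxz hu]
  cases h with
  | start => rw [dist_comm, hxz, dist_self, sub_zero]
  | antipode => rw [dist_self, hxz, sub_self]
  | @ray e c hc hce t ht =>
    rw [dist_start c ht.1.le (ht.2.le.trans hc.length_eq.ge), ← hc.apply_pi,
      hc.dist_eq ⟨Real.pi_pos.le, le_rfl⟩ (Set.Ioo_subset_Icc_self ht),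
      abs_of_pos (sub_pos.2 ht.2)]

theorem dist_eq (X : SphericalBuilding n B) (hxz : dist x z = π) (hu : ‖u‖ = 1)
    (hψ : ∀ e e', dist (ψ e) (ψ e') = angle (e : E (n + 1)) e') (h : IsSuspensionPoint z ψ v y)
    (h' : IsSuspensionPoint z ψ v' y') : dist y y' = angle v v' := by
  cases h with
  | start => exact h'.dist_left hxz hu
  | antipode => exact h'.dist_right hxz hu
  | @ray e c hc hce t ht =>
    have hy : IsSuspensionPoint z ψ (greatCircle u e t) (c.toFun t) := .ray e hc hce ht
    cases h' with
    | start => rw [dist_comm, angle_comm, hy.dist_left hxz hu]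
    | antipode => rw [dist_comm, angle_comm, hy.dist_right hxz hu]
    | @ray e' c' hc' hce' t' ht' =>
      have hangle : gAngle c c' = angle (e : E (n + 1)) e' := by
        rw [← hψ, ← hce, ← hce']
        rfl
      refine (angle_eq_of_inner_eq_cos (norm_greatCircle e.2 t) (norm_greatCircle e'.2 t')
        ⟨dist_nonneg, X.dist_le_pi _ _⟩ ?_).symm
      rw [X.cos_dist_of_isRayTo hc hc' (Set.Ioo_subset_Icc_self ht) (Set.Ioo_subset_Icc_self ht'),
        inner_greatCircle e.2 e'.2, hangle,
        inner_eq_cos_angle_of_norm_eq_one e.2.norm_right e'.2.norm_right]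

end IsSuspensionPoint

namespace SphericalBuilding

variable {n : ℕ} {B : Type*} [MetricSpace B] {x z : B} {Ax : Set (Directions x)}

theorem isRoundSphere_suspension (X : SphericalBuilding n B) (hxz : dist x z = π)
    (hAx : IsRoundSphere n Ax) : IsRoundSphere (n + 1) (suspension z Ax) := by
  obtain ⟨u, hu⟩ : ∃ u : E (n + 1), ‖u‖ = 1 := ⟨EuclideanSpace.single 0 1, by simp⟩
  obtain ⟨ψ, hψ, rfl⟩ := hAx.exists_tangent_parametrization hu
  choose F hF using fun v : USphere (n + 1) =>
    IsSuspensionPoint.exists_of_norm_eq_one (ψ := ψ) X hxz hu (norm_eq_of_mem_sphere v)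
  refine ⟨F, fun v v' => (hF v).dist_eq X hxz hu hψ (hF v'), ?_⟩
  refine (Set.range_subset_iff.2 fun v => (hF v).mem_suspension).antisymm fun y hy => ?_
  obtain ⟨v, hv, hy⟩ := IsSuspensionPoint.exists_of_mem_suspension hu hy
  refine ⟨⟨v, mem_sphere_zero_iff_norm.2 hv⟩, dist_eq_zero.1 ?_⟩
  rw [(hF _).dist_eq X hxz hu hψ hy, angle_self (ne_zero_of_norm_eq_one hv)]

theorem isApartment_suspension (X : SphericalBuilding n B) (hxz : dist x z = π)
    (hAx : IsRoundSphere n Ax) : X.IsApartment (suspension z Ax) := by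
  obtain ⟨F, hF, hFA⟩ := X.isRoundSphere_suspension hxz hAx
  exact hFA ▸ X.isApartment_range hF

theorem directionsOf_suspension (X : SphericalBuilding n B) (hxz : dist x z = π) :
    directionsOf (suspension z Ax) x = Ax := by
  refine Set.Subset.antisymm ?_ fun ξ hξ => ?_
  · rintro _ ⟨c, hc, rfl⟩
    obtain ⟨t, ht0, ht⟩ : ∃ t, 0 < t ∧ t ≤ c.length ∧ t < π :=
      ⟨min c.length 1, lt_min c.length_pos one_pos, min_le_left _ _,
        (min_le_right _ _).trans_lt (by linarith [Real.pi_gt_three])⟩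
    have hxt : dist x (c.toFun t) = t := dist_start c ht0.le ht.1
    rcases hc t ⟨ht0.le, ht.1⟩ with (h | h) | ⟨c', hc', hξ, s, hs, h⟩
    · exact absurd (hxt.symm.trans (.trans (congrArg (dist x) h) (dist_self x))) ht0.ne'
    · exact absurd (hxt.symm.trans (.trans (congrArg (dist x) h) hxz)) ht.2.ne
    · have hlen : s ≤ c'.length := hs.2.le.trans hc'.length_eq.ge
      obtain rfl : s = t := by rw [← hxt, ← h, dist_start c' hs.1.le hlen]
      rwa [← X.cat1.mk_eq_mk_of_apply_eq ht0 hlen ht.1 ht.2 h]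
  · obtain ⟨c, hc, rfl⟩ := X.exists_isRayTo hxz ξ
    refine ⟨c, fun t ht => ?_, rfl⟩
    rw [hc.length_eq] at ht
    rcases ht.1.eq_or_lt with rfl | h0
    · exact .inl (.inl c.map_zero)
    rcases ht.2.eq_or_lt with rfl | hπ
    · exact .inl (.inr hc.apply_pi)
    · exact .inr ⟨c, hc, hξ, t, ⟨h0, hπ⟩, rfl⟩

end SphericalBuilding

theorem IsConvex.subset_suspension {n : ℕ} {B : Type*} [MetricSpace B] {X : SphericalBuilding n B}
    {C : Set B} (hC : IsConvex C) {x : B} (hx : x ∈ C) {Ax : Set (Directions x)}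
    (hCA : directionsOf C x ⊆ Ax) {k : E (n + 1) → B}
    (hk : X.IsConeChart k) {u : E (n + 1)} (hu : ‖u‖ = 1) (hku : k u = x)
    (hCk : ∀ c ∈ C, ∃ y, ‖y‖ = 1 ∧ k y = c) : C ⊆ suspension (k (-u)) Ax := by
  intro c hc
  obtain ⟨y, hy, rfl⟩ := hCk c hc
  obtain rfl | rfl | ⟨e, he, t, ht, rfl⟩ := eq_or_eq_neg_or_exists_eq_greatCircle hu hy
  · exact .inl (.inl hku)
  · exact .inl (.inr rfl)
  · exact .inr ⟨hk.geodesic hku he, hk.isRayTo_geodesic hku he,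
      hCA (hC.mk_mem_directionsOf hx ht.1 ht.2.le ht.2 hc), t, ht, rfl⟩

end SphBuild

end

theorem corollary3p4_general {n : ℕ} {B : Type*} [MetricSpace B]
    (X : SphBuild.SphericalBuilding n B) {C : Set B}
    (hconv : SphBuild.IsConvex C) (hsph : SphBuild.IsSpherical C) {x : B} (hx : x ∈ C)
    {Ax : Set (SphBuild.Directions x)} (hAx : SphBuild.IsRoundSphere n Ax)
    (hCA : SphBuild.directionsOf C x ⊆ Ax) :
    ∃ A : Set B, X.IsApartment A ∧ C ⊆ A ∧ SphBuild.directionsOf A x = Ax := by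
  obtain ⟨k, hk, hCk⟩ := X.exists_isConeChart_superset hconv hsph ⟨x, hx⟩
  obtain ⟨u, hu, hku⟩ := hCk x hx
  have hu0 := SphBuild.ne_zero_of_norm_eq_one hu
  have hxz : dist x (k (-u)) = Real.pi := by
    rw [← hku, hk.dist_eq hu0 (neg_ne_zero.2 hu0),
      InnerProductGeometry.angle_self_neg_of_nonzero hu0]
  exact ⟨SphBuild.suspension (k (-u)) Ax, X.isApartment_suspension hxz hAx,
    hconv.subset_suspension hx hCA hk hu hku hCk, X.directionsOf_suspension hxz⟩

theorem corollary3p4 {n : ℕ} {B : Type*} [MetricSpace B] [CompleteSpace B]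
    (X : SphBuild.SphericalBuilding n B) (C : Set B) (hclosed : IsClosed C)
    (hconv : SphBuild.IsConvex C) (hsph : SphBuild.IsSpherical C) (x : B) (hx : x ∈ C)
    (Ax : Set (SphBuild.Directions x)) (hAx : SphBuild.IsRoundSphere n Ax)
    (hCA : SphBuild.directionsOf C x ⊆ Ax) :
    ∃ A : Set B, X.IsApartment A ∧ C ⊆ A ∧ SphBuild.directionsOf A x = Ax :=
  corollary3p4_general X hconv hsph hx hAx hCA
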